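/- **Construction.** Fix an integer $m\ge 2$ and reals $r\in(0,1)$, $\rho\in(0,1]$. For a prime $p$ let $n=n(p)=p^{m^2}(p^m-1)$, and let $D=D(p)\le n$ be integers with $D/n\to\rho$ as $p\to\infty$ over the primes. Let $\mathbb F$ be a finite field of characteristic $p$ that contains $\mathbb F_{p^m}$ and all roots of $g(X)=X^{p^m}+X^p+X$. Let $G$ be the additive group of the roots of $g$, acting on $\mathbb F$ by the translations $x\mapsto x+a$, and let $H=\mathbb F_{p^m}^\times$, acting by the scalings $x\mapsto hx$. Put $h(X)=X^{|H|}$, and let $A=\langle G,H\rangle\le \mathrm{AGL}(1,\mathbb F)$. Let $\alpha\in\mathbb F$ have trivial stabilizer in $A$, and let $\Omega=\{\phi(\alpha):\phi\in A\}$. For a non-constant polynomial $u$, every $f\in\mathbb F[X]$ has a unique expansion $f=\sum_i c_i u^i$ with $\deg c_i<\deg u$; put $\deg_u f=\max_i\deg c_i$, with $\deg 0=-\infty$. Let $$\mathcal W_{r,D}=\{f\in\mathbb F[X]:\deg f<D,\ \deg_g f<r|G|,\ \deg_h f<r|H|\},\qquad \mathcal C=\mathcal C_D=\{(f(\beta))_{\beta\in\Omega}: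 f\in\mathcal W_{r,D}\}.$$ Let $\mathsf B$ be the bipartite graph whose edges are the elements of $A$, whose left and right vertices are the right cosets $G\phi$ and $H\phi$ $(\phi\in A)$, and in which the edge $\phi$ joins $G\phi$ to $H\phi$; the edge $\phi$ is identified with the coordinate $\phi(\alpha)\in\Omega$. The local code at a left (right) vertex is the Reed–Solomon code of evaluations, at the points $\phi(\alpha)$ of the edges $\phi$ at that vertex, of all polynomials of degree $<r|G|$ (respectively $<r|H|$). The Tanner code of $\mathsf B$ is the set of words on the edges whose restriction to the edges at each vertex lies in the local code of that vertex. **Theorem.** Such $\mathbb F$ and $\alpha$ exist for every prime $p$, and for all of them: 0. *(Expander code.)* The invariant polynomial $\prod_{a\in G}(X-a)$ of $G$ is $g$, and $|H|=p^m-1$, so $h=X^{p^m-1}$. The map $\phi\mapsto\phi(\alpha)$ is a bijection $A\to\Omega$, and $\mathcal C$ has length $|\Omega|=n$. The code $\mathcal C_D$ is contained in the Tanner code of $\mathsf B$ with the Reed–Solomon local codes above, with equality when $D=n$. The second largest singular value of the normalized bi-adjacency operator of $\mathsf B$ is at most $\sqrt{\frac1p+\frac1{p^m-1}}$. 1. The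 left and right local codes have lengths $|G|=p^m$ and $|H|=p^m-1$, both $\Theta(n^{1/(m+1)})$. As $p\to\infty$ their rate is at most $r+o(1)$ and their relative distance at least $1-r-o(1)$. 2. As $p\to\infty$, the relative distance of $\mathcal C_D$ is at least $\max(1-\rho,(1-r)^2)-o(1)$. 3. As $p\to\infty$, the rate of $\mathcal C_D$ is at least $$\frac{r^{2m+1}-\max(0,r-\rho)^{2m+1}}{(2m+1)!}-o(1).$$ In particular, for $D=n$ the relative distance is at least $(1-r)^2-o(1)$ and the rate is at least $\frac{r^{2m+1}}{(2m+1)!}-o(1)$, where $\frac{r^{2m+1}}{(2m+1)!}>0$ for every $r\in(0,1)$, also when $r\le 1/2$. All the $o(1)$ terms tend to $0$ as $p\to\infty$, uniformly in the choice of $\mathbb F$ and $\alpha$. -/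

import Mathlib

open Polynomial Filter Asymptotics Topology

noncomputable section

namespace AlgExpander

universe u

/-! ## Linear codes over an arbitrary coordinate set -/

section Codes

variable {F : Type*} [Field F] {ι : Type*}

/-- Evaluation of polynomials at a family of points, as a linear map. -/
def evalMap (x : ι → F) : F[X] →ₗ[F] (ι → F) :=
  LinearMap.pi fun i => Polynomial.leval (x i)

/-- The Reed-Solomon code with evaluation points `x` : all evaluations of polynomials of
degree less than `k`. -/
def rsCode (x : ι → F) (k : ℕ) : Submodule F (ι → F) :=
  (Polynomial.degreeLT F k).map (evalMap x)

/-- The rate `dim C / length` of a linear code. -/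
def rate (C : Submodule F (ι → F)) : ℝ :=
  (Module.finrank F C : ℝ) / (Nat.card ι : ℝ)

/-- The minimum Hamming distance between two distinct codewords (it is `0` by convention for
the code that has a single word). -/
def minDist (C : Submodule F (ι → F)) : ℕ :=
  sInf {d | ∃ x ∈ C, ∃ y ∈ C, x ≠ y ∧ d = {i | x i ≠ y i}.ncard}

/-- The relative minimum distance. -/
def relDist (C : Submodule F (ι → F)) : ℝ :=
  (minDist C : ℝ) / (Nat.card ι : ℝ)

end Codes

/-! ## Bipartite multigraphs given by an edge set `E` and the two endpoint maps -/

section Graphs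

variable {E L R : Type*}

/-- The Tanner code on a bipartite graph: the words on the edges whose restriction to the edges
at every vertex belongs to the local code of that vertex. -/
def tannerCode {F : Type*} [Field F] (left : E → L) (right : E → R)
    (CL : ∀ v : L, Submodule F ({e : E // left e = v} → F))
    (CR : ∀ v : R, Submodule F ({e : E // right e = v} → F)) : Submodule F (E → F) where
  carrier := {c | (∀ v : L, (fun e : {e : E // left e = v} => c e) ∈ CL v) ∧
    ∀ v : R, (fun e : {e : E // right e = v} => c e) ∈ CR v}
  add_mem' := fun ha hb =>
    ⟨fun v => (CL v).add_mem (ha.1 v) (hb.1 v), fun v => (CR v).add_mem (ha.2 v) (hb.2 v)⟩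
  zero_mem' := ⟨fun v => (CL v).zero_mem, fun v => (CR v).zero_mem⟩
  smul_mem' := fun t _ ha =>
    ⟨fun v => (CL v).smul_mem t (ha.1 v), fun v => (CR v).smul_mem t (ha.2 v)⟩

/-- The bi-adjacency matrix: the number of edges between a left and a right vertex. -/
def biadjacency (left : E → L) (right : E → R) : Matrix L R ℂ :=
  fun v w => (Nat.card {e : E // left e = v ∧ right e = w} : ℂ)

/-- The second largest singular value of the normalized bi-adjacency operator
`T = (dL * dR)^(-1/2) B : ℓ²(R) → ℓ²(L)` of a biregular bipartite graph with left degree `dL`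
and right degree `dR` : the supremum of `‖T f‖` over the unit vectors `f` orthogonal to the
constant function `1`. -/
def secondSingularValue [Fintype L] [Fintype R] (left : E → L) (right : E → R) (dL dR : ℕ) : ℝ :=
  sSup {s : ℝ | ∃ f : EuclideanSpace ℂ R, ‖f‖ = 1 ∧
    inner ℂ (WithLp.toLp 2 (fun _ => 1) : EuclideanSpace ℂ R) f = 0 ∧
    s = ‖(WithLp.toLp 2 ((((Real.sqrt (dL * dR))⁻¹ : ℝ) : ℂ) •
      (biadjacency left right).mulVec (WithLp.ofLp f)) : EuclideanSpace ℂ L)‖}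

end Graphs

/-! ## The degree of a polynomial in base `u` -/

section BaseDegree

variable {F : Type*} [Field F]

/-- The `i`-th coefficient of the `u`-adic expansion `f = ∑ i, c i * u ^ i`. -/
def baseDigit (u : F[X]) : ℕ → F[X] → F[X]
  | 0, f => f % u
  | i + 1, f => baseDigit u i (f / u)

/-- The `u`-base degree: the largest degree of a coefficient of the `u`-adic expansion
(`⊥` for the zero polynomial). The coefficients of index larger than `natDegree f` vanish. -/
def baseDegree (u f : F[X]) : WithBot ℕ :=
  (Finset.range (f.natDegree + 1)).sup fun i => (baseDigit u i f).degree

lemma add_div' (u f g : F[X]) : (f + g) / u = f / u + g / u := by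
  by_cases hu : u = 0
  · simp [hu]
  · apply mul_left_cancel₀ hu
    have h1 := EuclideanDomain.div_add_mod f u
    have h2 := EuclideanDomain.div_add_mod g u
    have h3 := EuclideanDomain.div_add_mod (f + g) u
    rw [Polynomial.add_mod] at h3
    linear_combination h3 - h1 - h2

lemma C_mul_mod' (u f : F[X]) (a : F) : (C a * f) % u = C a * (f % u) := by
  simp only [← Polynomial.smul_eq_C_mul, Polynomial.mod_def, Polynomial.smul_modByMonic]

lemma C_mul_div' (u f : F[X]) (a : F) : (C a * f) / u = C a * (f / u) := by
  by_cases hu : u = 0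
  · simp [hu]
  · apply mul_left_cancel₀ hu
    have h1 := EuclideanDomain.div_add_mod f u
    have h3 := EuclideanDomain.div_add_mod (C a * f) u
    rw [C_mul_mod'] at h3
    linear_combination h3 - C a * h1

lemma baseDigit_add (u : F[X]) (i : ℕ) (f g : F[X]) :
    baseDigit u i (f + g) = baseDigit u i f + baseDigit u i g := by
  induction i generalizing f g with
  | zero => exact Polynomial.add_mod f g u
  | succ i ih => simp only [baseDigit, add_div', ih]

lemma baseDigit_C_mul (u : F[X]) (i : ℕ) (a : F) (f : F[X]) :
    baseDigit u i (C a * f) = C a * baseDigit u i f := by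
  induction i generalizing f with
  | zero => exact C_mul_mod' u f a
  | succ i ih => simp only [baseDigit, C_mul_div', ih]

lemma baseDigit_zero (u : F[X]) (i : ℕ) : baseDigit u i (0 : F[X]) = 0 := by
  induction i with
  | zero => simp [baseDigit]
  | succ i ih => simpa [baseDigit] using ih

lemma natDegree_div_le (u f : F[X]) (hu : 0 < u.natDegree) :
    (f / u).natDegree ≤ f.natDegree - 1 := by
  rcases eq_or_ne (f / u) 0 with h | h
  · simp [h]
  · have hf : f ≠ 0 := by rintro rfl; simp at h
    have := Polynomial.natDegree_lt_natDegree h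
      (Polynomial.degree_div_lt hf (Polynomial.natDegree_pos_iff_degree_pos.1 hu))
    omega

lemma degree_baseDigit_lt (u : F[X]) (hu : 0 < u.natDegree) (i : ℕ) (f : F[X]) :
    (baseDigit u i f).degree < u.degree := by
  induction i generalizing f with
  | zero => exact Polynomial.degree_mod_lt f (by rintro rfl; simp at hu)
  | succ i ih => exact ih _

/-- The digits do give the expansion in base `u`. -/
lemma sum_baseDigit (u : F[X]) (hu : 0 < u.natDegree) (f : F[X]) (n : ℕ) (hn : f.natDegree < n) :
    ∑ i ∈ Finset.range n, baseDigit u i f * u ^ i = f := by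
  induction n generalizing f with
  | zero => omega
  | succ n ih =>
    rw [Finset.sum_range_succ']
    have key : ∑ i ∈ Finset.range n, baseDigit u i (f / u) * u ^ i = f / u := by
      rcases Nat.eq_zero_or_pos f.natDegree with h0 | h0
      · have : f / u = 0 := (Polynomial.div_eq_zero_iff (by rintro rfl; simp at hu)).2
          (Polynomial.degree_lt_degree (by omega))
        simp [this, baseDigit_zero]
      · exact ih _ (by have := natDegree_div_le u f hu; omega)
    have h1 := EuclideanDomain.div_add_mod f u
    have h2 : ∑ i ∈ Finset.range n, baseDigit u (i + 1) f * u ^ (i + 1)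
        = u * (f / u) := by
      conv_rhs => rw [← key, Finset.mul_sum]
      refine Finset.sum_congr rfl fun i _ => ?_
      simp only [baseDigit]
      ring
    rw [h2]
    simpa [baseDigit] using h1

lemma baseDigit_eq_zero_of_lt (u : F[X]) (i : ℕ) (f : F[X])
    (h : f.natDegree < i) : baseDigit u i f = 0 := by
  rcases Nat.eq_zero_or_pos u.natDegree with hu | hu
  · obtain ⟨a, rfl⟩ := Polynomial.natDegree_eq_zero.1 hu
    obtain ⟨i, rfl⟩ : ∃ j, i = j + 1 := ⟨i - 1, by omega⟩
    by_cases ha : a = 0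
    · simp [baseDigit, ha, baseDigit_zero]
    · have : ∀ (j : ℕ) (g : F[X]), baseDigit (C a) j g = 0 := by
        intro j
        induction j with
        | zero =>
          intro g
          exact EuclideanDomain.mod_eq_zero.2
            (Polynomial.isUnit_C.2 (isUnit_iff_ne_zero.2 ha)).dvd
        | succ j ih => intro g; exact ih _
      exact this _ _
  · induction i generalizing f with
    | zero => omega
    | succ i ih =>
      rcases Nat.eq_zero_or_pos f.natDegree with h0 | h0
      · have : f / u = 0 := (Polynomial.div_eq_zero_iff (by rintro rfl; simp at hu)).2
          (Polynomial.degree_lt_degree (by omega))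
        simp [baseDigit, this, baseDigit_zero]
      · exact ih _ (by have := natDegree_div_le u f hu; omega)

lemma baseDegree_lt_iff (u f : F[X]) (k : ℕ) :
    baseDegree u f < (k : WithBot ℕ) ↔ ∀ i, (baseDigit u i f).degree < (k : WithBot ℕ) := by
  have hk : (⊥ : WithBot ℕ) < (k : WithBot ℕ) := WithBot.bot_lt_coe k
  refine (Finset.sup_lt_iff hk).trans ⟨fun h i => ?_, fun h i _ => h i⟩
  by_cases hi : f.natDegree < i
  · rw [baseDigit_eq_zero_of_lt u i f hi, degree_zero]
    exact WithBot.bot_lt_coe k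
  · exact h i (Finset.mem_range.2 (by omega))

end BaseDegree

/-! ## The general construction for a translation group and a scaling group -/

section Construction

variable {F : Type u} [Field F]

/-- The group `{x ↦ x + s : s ∈ U}`, a subgroup of the affine group `AGL(1, F)`. -/
def translationGroup (U : AddSubgroup F) : Subgroup (F ≃ᵃ[F] F) :=
  (AddSubgroup.toSubgroup U).map (AffineEquiv.constVAddHom F F)

/-- The group `{x ↦ t x : t ∈ V}`, a subgroup of the affine group `AGL(1, F)`. -/
def scalingGroup (V : Subgroup Fˣ) : Subgroup (F ≃ᵃ[F] F) :=
  V.map (AffineEquiv.homothetyUnitsMulHom (0 : F))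

/-- The group `A` generated by the translations by `U` and the scalings by `V`. -/
def affGroup (U : AddSubgroup F) (V : Subgroup Fˣ) : Subgroup (F ≃ᵃ[F] F) :=
  translationGroup U ⊔ scalingGroup V

/-- The annihilator polynomial `∏ s ∈ U, (X - s)`, invariant under translations by `U`
(for finite `U`). -/
def annihilator (U : AddSubgroup F) : F[X] :=
  ∏ᶠ s : U, (X - C (s : F))

/-- The monomial `X ^ |V|`, invariant under scalings by `V`. -/
def scalingInvariant (V : Subgroup Fˣ) : F[X] :=
  X ^ Nat.card V

/-- The space of message polynomials `f` with `deg f < D`, base-`g` degree `< r |G|` and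
base-`h` degree `< r |H|`. For a natural number `k`, `k < r N` is the same as `k < ⌈r N⌉₊`. -/
def messageSpace (U : AddSubgroup F) (V : Subgroup Fˣ) (r : ℝ) (D : ℕ) : Submodule F F[X] where
  carrier := {f | f.degree < (D : WithBot ℕ) ∧
    baseDegree (annihilator U) f < (⌈r * Nat.card U⌉₊ : WithBot ℕ) ∧
    baseDegree (scalingInvariant V) f < (⌈r * Nat.card V⌉₊ : WithBot ℕ)}
  add_mem' := by
    rintro f g ⟨hf, hf1, hf2⟩ ⟨hg, hg1, hg2⟩
    simp only [baseDegree_lt_iff] at hf1 hf2 hg1 hg2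
    refine ⟨(degree_add_le f g).trans_lt (max_lt hf hg), ?_, ?_⟩
    · rw [baseDegree_lt_iff]
      intro i
      rw [baseDigit_add]
      exact (degree_add_le _ _).trans_lt (max_lt (hf1 i) (hg1 i))
    · rw [baseDegree_lt_iff]
      intro i
      rw [baseDigit_add]
      exact (degree_add_le _ _).trans_lt (max_lt (hf2 i) (hg2 i))
  zero_mem' := by
    refine ⟨by simp, ?_, ?_⟩ <;>
    · rw [baseDegree_lt_iff]
      intro i
      simp [baseDigit_zero]
  smul_mem' := by
    rintro a f ⟨hf, hf1, hf2⟩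
    simp only [baseDegree_lt_iff] at hf1 hf2
    refine ⟨(degree_smul_le a f).trans_lt hf, ?_, ?_⟩
    · rw [baseDegree_lt_iff]
      intro i
      rw [smul_eq_C_mul, baseDigit_C_mul, ← smul_eq_C_mul]
      exact (degree_smul_le _ _).trans_lt (hf1 i)
    · rw [baseDegree_lt_iff]
      intro i
      rw [smul_eq_C_mul, baseDigit_C_mul, ← smul_eq_C_mul]
      exact (degree_smul_le _ _).trans_lt (hf2 i)

/-- The orbit of `α` under the group `A`, the set of evaluation points. -/
def Omega (U : AddSubgroup F) (V : Subgroup Fˣ) (α : F) : Set F :=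
  {x | ∃ φ ∈ affGroup U V, φ α = x}

/-- The evaluation code `C(G, H; r, D)`, whose coordinates are the points of the orbit of `α`. -/
def code (U : AddSubgroup F) (V : Subgroup Fˣ) (α : F) (r : ℝ) (D : ℕ) :
    Submodule F (Omega U V α → F) :=
  (messageSpace U V r D).map (evalMap fun x : Omega U V α => (x : F))

/-! ### The bipartite coset graph -/

/-- The left vertices: the right cosets `G φ` in `A`. -/
def LeftVertex (U : AddSubgroup F) (V : Subgroup Fˣ) : Type u :=
  Quotient (QuotientGroup.rightRel ((translationGroup U).subgroupOf (affGroup U V)))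

/-- The right vertices: the right cosets `H φ` in `A`. -/
def RightVertex (U : AddSubgroup F) (V : Subgroup Fˣ) : Type u :=
  Quotient (QuotientGroup.rightRel ((scalingGroup V).subgroupOf (affGroup U V)))

/-- The left endpoint `G φ` of the edge `φ ∈ A`. -/
def leftEnd (U : AddSubgroup F) (V : Subgroup Fˣ) (φ : affGroup U V) : LeftVertex U V :=
  Quotient.mk _ φ

/-- The right endpoint `H φ` of the edge `φ ∈ A`. -/
def rightEnd (U : AddSubgroup F) (V : Subgroup Fˣ) (φ : affGroup U V) : RightVertex U V :=
  Quotient.mk _ φ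

/-- The map `φ ↦ φ α` from edges to evaluation points. -/
def edgePoint (U : AddSubgroup F) (V : Subgroup Fˣ) (α : F) (φ : affGroup U V) : Omega U V α :=
  ⟨(φ : F ≃ᵃ[F] F) α, φ, φ.2, rfl⟩

/-- The local code of a left vertex: a Reed-Solomon code on the edges at that vertex, the edge
`φ` carrying the evaluation point `φ α`. -/
def leftLocalCode (U : AddSubgroup F) (V : Subgroup Fˣ) (α : F) (r : ℝ) (v : LeftVertex U V) :
    Submodule F ({φ : affGroup U V // leftEnd U V φ = v} → F) :=
  rsCode (fun φ => (edgePoint U V α φ : F)) ⌈r * Nat.card U⌉₊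

/-- The local code of a right vertex. -/
def rightLocalCode (U : AddSubgroup F) (V : Subgroup Fˣ) (α : F) (r : ℝ) (v : RightVertex U V) :
    Submodule F ({φ : affGroup U V // rightEnd U V φ = v} → F) :=
  rsCode (fun φ => (edgePoint U V α φ : F)) ⌈r * Nat.card V⌉₊

/-- The Tanner code on the coset graph with the Reed-Solomon local codes. -/
def cosetTannerCode (U : AddSubgroup F) (V : Subgroup Fˣ) (α : F) (r : ℝ) :
    Submodule F (affGroup U V → F) :=
  tannerCode (leftEnd U V) (rightEnd U V) (leftLocalCode U V α r) (rightLocalCode U V α r)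

/-- The code with its coordinates relabelled by the edges of the coset graph. -/
def codeOnEdges (U : AddSubgroup F) (V : Subgroup Fˣ) (α : F) (r : ℝ) (D : ℕ) :
    Submodule F (affGroup U V → F) :=
  (code U V α r D).map (LinearMap.funLeft F F (edgePoint U V α))

instance [Finite F] : Finite (F ≃ᵃ[F] F) := DFunLike.finite _

instance [Finite F] (U : AddSubgroup F) (V : Subgroup Fˣ) : Fintype (LeftVertex U V) :=
  haveI : Finite (LeftVertex U V) := Quotient.finite _
  Fintype.ofFinite _

instance [Finite F] (U : AddSubgroup F) (V : Subgroup Fˣ) : Fintype (RightVertex U V) :=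
  haveI : Finite (RightVertex U V) := Quotient.finite _
  Fintype.ofFinite _

/-- The second singular value of the normalized bi-adjacency operator of the coset graph. -/
def cosetSigmaTwo [Finite F] (U : AddSubgroup F) (V : Subgroup Fˣ) : ℝ :=
  secondSingularValue (leftEnd U V) (rightEnd U V) (Nat.card U) (Nat.card V)

end Construction

/-! ## The instantiation -/

section Instantiation

variable (p m : ℕ) (F : Type u) [Field F]

/-- The additive group of the roots of `X ^ (p ^ m) + X ^ p + X` in `F`. -/
def rootGroup [Fact p.Prime] [CharP F p] : AddSubgroup F where
  carrier := {x | x ^ p ^ m + x ^ p + x = 0}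
  add_mem' := by
    intro a b ha hb
    simp only [Set.mem_ofPred_eq] at ha hb ⊢
    rw [add_pow_char_pow, add_pow_char]
    linear_combination ha + hb
  zero_mem' := by
    simp [(Fact.out : p.Prime).ne_zero]
  neg_mem' := by
    intro a ha
    simp only [Set.mem_ofPred_eq] at ha ⊢
    have h1 : (-a) ^ p ^ m = -(a ^ p ^ m) := by
      have h := add_pow_char_pow (-a) a p m
      rw [neg_add_cancel, zero_pow (pow_ne_zero _ (Fact.out : p.Prime).ne_zero)] at h
      linear_combination -h
    have h2 : (-a) ^ p = -(a ^ p) := by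
      have h := add_pow_char (-a) a p
      rw [neg_add_cancel, zero_pow (Fact.out : p.Prime).ne_zero] at h
      linear_combination -h
    rw [h1, h2]
    linear_combination -ha

/-- The group of nonzero elements `t` of `F` with `t ^ (p ^ m) = t`. If `F` is a finite field of
characteristic `p` that contains the field with `p ^ m` elements, this is its multiplicative
group. -/
def subfieldUnits : Subgroup Fˣ where
  carrier := {t | t ^ p ^ m = t}
  mul_mem' := by
    intro a b ha hb
    simp only [Set.mem_ofPred_eq] at ha hb ⊢
    rw [mul_pow, ha, hb]
  one_mem' := one_pow _
  inv_mem' := by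
    intro a ha
    simp only [Set.mem_ofPred_eq] at ha ⊢
    rw [inv_pow, ha]

/-- `F` is large enough, and `α` is an admissible base point: `F` contains all the roots of
`X ^ (p ^ m) + X ^ p + X` and a field with `p ^ m` elements (the roots of `X ^ (p ^ m) - X`), and
`α` has a trivial stabilizer in the affine group generated by the two subgroups. -/
structure Admissible [Fact p.Prime] [CharP F p] (α : F) : Prop where
  splits_add : (X ^ p ^ m + X ^ p + X : F[X]).Splits
  splits_mul : (X ^ p ^ m - X : F[X]).Splits
  free : ∀ φ ∈ affGroup (rootGroup p m F) (subfieldUnits p m F), φ α = α → φ = 1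

end Instantiation

/-- The length `p ^ (m ^ 2) * (p ^ m - 1)` of the code. -/
def codeLength (p m : ℕ) : ℕ := p ^ m ^ 2 * (p ^ m - 1)

end AlgExpander

end

set_option linter.unusedSectionVars false

namespace AlgExpander

/-! Write `q = p ^ m`, `g = X ^ q + X ^ p + X` and `W = scaledSpan U V`.

Group. Every element of `A` has the form `x ↦ t x + b` with `t ∈ H` and `b ∈ W`, where `W` is the
`𝔽_q`-span of `G`. Roots of `g` independent over `𝔽_p` stay independent over `𝔽_q`
(`eq_zero_of_sum_mul_eq_zero`, a shortest-relation argument with Frobenius), so `|W| = q ^ m` and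
`|A| = q ^ m (q - 1)`. Any `α` outside `W` has trivial stabilizer.

Tanner code. A vertex is a fibre of `g` or `h` on `Ω`. Replacing the base polynomial by its constant
value on a fibre turns a low base degree into a low-degree local polynomial. Conversely, if the
interpolant of a Tanner word is low on all fibres, each forbidden coefficient of its digits defines
a polynomial with more zeros than its degree allows (`baseDegree_lt_of_fibres`).

Spectrum and distance. Right vertices are the points of `W`; left vertices are cosets of the groups
`t⁻¹ G`. A non-trivial character of `W` is trivial on `t⁻¹ G` for at most `(q - 1) / p` values of
`t`, because these `t⁻¹` together with `0` form a proper additive subgroup of `𝔽_q`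
(`mul_card_trivial_le`). Parseval bounds the squared second singular value by `1 / p`. Local
distance `1 - r` and expander mixing give relative distance `(1 - r) ^ 2 - (1 - r) / √p`
(`mul_card_le_card_of_local`); the bound `1 - ρ` only uses `deg f < D`.

Rate. Call a bound on the digit degrees in both bases a weight; weights add under products. Four
families of monic building blocks are used: `X` of weight `1`; `g ^ (q ^ j)` of weight `p`; `g ^ (p
^ (m - 1) q ^ j)` of weight `p ^ (m - 1)`; and a `q`-linearized polynomial of degree `q ^ m` and
weight `1` that is also a polynomial in `g` (`hasLowMonic_linearized`). Products with exponents in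
mixed-radix ranges have distinct degrees. Those of weight `< R = r (q - 1)` are lattice points of a
simplex, cut off in one coordinate by `D`, and `exists_lowDegrees` bounds their number below by its
volume. This gives a limiting rate with exponent `2 m`, which dominates the stated bound with
exponent `2 m + 1` (`pow_succ_sub_div_factorial_le`). -/

/-! ## Polynomials with low digits in a given base -/

section BaseSpan

variable {F : Type*} [Field F]

/-- The span of the products `X ^ a * u ^ i` with `a ≤ w`: the polynomials whose `u`-adic
digits have degree at most `w`, if `w < deg u`. -/
noncomputable def baseSpan (u : F[X]) (w : ℕ) : Submodule F F[X] :=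
  Submodule.span F {f | ∃ a ≤ w, ∃ i : ℕ, f = X ^ a * u ^ i}

lemma X_pow_mul_pow_mem_baseSpan (u : F[X]) {a w : ℕ} (h : a ≤ w) (i : ℕ) :
    X ^ a * u ^ i ∈ baseSpan u w :=
  Submodule.subset_span ⟨a, h, i, rfl⟩

lemma one_mem_baseSpan (u : F[X]) (w : ℕ) : (1 : F[X]) ∈ baseSpan u w := by
  simpa using X_pow_mul_pow_mem_baseSpan u (Nat.zero_le w) 0

lemma self_mem_baseSpan (u : F[X]) (w : ℕ) : u ∈ baseSpan u w := by
  simpa using X_pow_mul_pow_mem_baseSpan u (Nat.zero_le w) 1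

lemma baseSpan_mono (u : F[X]) {w w' : ℕ} (h : w ≤ w') : baseSpan u w ≤ baseSpan u w' :=
  Submodule.span_mono fun _ ⟨a, ha, i, hi⟩ => ⟨a, ha.trans h, i, hi⟩

/-- The spanning products multiply to spanning products without any reduction modulo `u`, so weights
add. This holds even when `w + w'` exceeds `deg u`; the link with digits is only made at the end,
for small weights. -/
lemma mul_mem_baseSpan {u f f' : F[X]} {w w' : ℕ} (hf : f ∈ baseSpan u w)
    (hf' : f' ∈ baseSpan u w') : f * f' ∈ baseSpan u (w + w') := by
  have h := Submodule.mul_mem_mul hf hf'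
  rw [baseSpan, baseSpan, Submodule.span_mul_span] at h
  refine Submodule.span_mono ?_ h
  rintro _ ⟨_, ⟨a, ha, i, rfl⟩, _, ⟨b, hb, j, rfl⟩, rfl⟩
  exact ⟨a + b, add_le_add ha hb, i + j, by ring⟩

lemma pow_mem_baseSpan {u f : F[X]} {w : ℕ} (hf : f ∈ baseSpan u w) (e : ℕ) :
    f ^ e ∈ baseSpan u (e * w) := by
  induction e with
  | zero => simpa using one_mem_baseSpan u 0
  | succ e ih =>
    rw [pow_succ, Nat.succ_mul]
    exact mul_mem_baseSpan ih hf

lemma baseDigit_mul_pow {u c : F[X]} (hc : c.degree < u.degree) (i j : ℕ) :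
    baseDigit u i (c * u ^ j) = if i = j then c else 0 := by
  have hu : u ≠ 0 := by rintro rfl; simp at hc
  induction j generalizing i with
  | zero =>
    cases i with
    | zero => simp [baseDigit, (Polynomial.mod_eq_self_iff hu).2 hc]
    | succ i => simp [baseDigit, (Polynomial.div_eq_zero_iff hu).2 hc, baseDigit_zero]
  | succ j ih =>
    have h : c * u ^ (j + 1) = u * (c * u ^ j) := by ring
    cases i with
    | zero =>
      rw [h, baseDigit, EuclideanDomain.mod_eq_zero.2 (dvd_mul_right _ _)]
      simp
    | succ i =>
      rw [h, baseDigit, mul_div_cancel_left₀ _ hu, ih]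
      simp

/-- Below `deg u` the spanning products `X ^ a * u ^ i` have a single digit `X ^ a`, and digits are
linear. -/
lemma degree_baseDigit_lt_of_mem_baseSpan {u f : F[X]} {w k : ℕ} (hu : w < u.natDegree)
    (hk : w < k) (hf : f ∈ baseSpan u w) (i : ℕ) :
    (baseDigit u i f).degree < (k : WithBot ℕ) := by
  induction hf using Submodule.span_induction with
  | mem f hf =>
    obtain ⟨a, ha, j, rfl⟩ := hf
    rw [baseDigit_mul_pow]
    · split_ifs
      · rw [degree_X_pow]
        exact_mod_cast ha.trans_lt hk
      · simp
    · rw [degree_X_pow, degree_eq_natDegree (by rintro rfl; simp at hu)]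
      exact_mod_cast ha.trans_lt hu
  | zero => simp [baseDigit_zero]
  | add f f' _ _ hf hf' =>
    rw [baseDigit_add]
    exact (degree_add_le _ _).trans_lt (max_lt hf hf')
  | smul a f _ hf =>
    rw [smul_eq_C_mul, baseDigit_C_mul, ← smul_eq_C_mul]
    exact (degree_smul_le _ _).trans_lt hf

/-- There is a monic polynomial of degree `t` whose digits in the bases `u` and `v` have degree
at most `w` (when `w` is less than the degrees of `u` and `v`). -/
def HasLowMonic (u v : F[X]) (t w : ℕ) : Prop :=
  ∃ f : F[X], f.Monic ∧ f.natDegree = t ∧ f ∈ baseSpan u w ∧ f ∈ baseSpan v w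

lemma HasLowMonic.mul {u v : F[X]} {t w t' w' : ℕ} (h : HasLowMonic u v t w)
    (h' : HasLowMonic u v t' w') : HasLowMonic u v (t + t') (w + w') := by
  obtain ⟨f, hf, rfl, hu, hv⟩ := h
  obtain ⟨f', hf', rfl, hu', hv'⟩ := h'
  exact ⟨f * f', hf.mul hf', hf.natDegree_mul hf', mul_mem_baseSpan hu hu',
    mul_mem_baseSpan hv hv'⟩

lemma HasLowMonic.pow {u v : F[X]} {t w : ℕ} (h : HasLowMonic u v t w) (e : ℕ) :
    HasLowMonic u v (e * t) (e * w) := by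
  obtain ⟨f, hf, rfl, hu, hv⟩ := h
  exact ⟨f ^ e, hf.pow e, hf.natDegree_pow e, pow_mem_baseSpan hu e, pow_mem_baseSpan hv e⟩

end BaseSpan

/-! ## Counting the degrees of polynomials with low digits -/

section Counting

/-- The mean value inequality for `x ^ (n + 1)`: it compares one slice of a simplex with the
corresponding piece of the integral. -/
lemma pow_succ_sub_pow_succ_le {x y : ℝ} (hy : 0 ≤ y) (hxy : y ≤ x) (n : ℕ) :
    x ^ (n + 1) - y ^ (n + 1) ≤ (n + 1) * (x - y) * x ^ n := by
  induction n with
  | zero => simp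
  | succ n ih =>
    have h1 : y ^ (n + 1) ≤ x ^ (n + 1) := pow_le_pow_left₀ hy hxy _
    have h2 := mul_le_mul_of_nonneg_left ih (hy.trans hxy)
    have h3 := mul_le_mul_of_nonneg_left h1 (sub_nonneg.2 hxy)
    push_cast
    calc x ^ (n + 1 + 1) - y ^ (n + 1 + 1)
        = x * (x ^ (n + 1) - y ^ (n + 1)) + (x - y) * y ^ (n + 1) := by ring
      _ ≤ x * ((n + 1) * (x - y) * x ^ n) + (x - y) * x ^ (n + 1) := add_le_add h2 h3
      _ = _ := by ring

variable {F : Type*} [Field F]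

/-- For every `R ≤ B` there are at least `c R ^ k / k!` degrees `t < T` of monic polynomials whose
digits have degree less than `R`. -/
def LowDegreeCount (u v : F[X]) (B : ℝ) (k T : ℕ) (c : ℝ) : Prop :=
  ∀ R : ℝ, 0 < R → R ≤ B → ∃ S : Finset ℕ,
    (∀ t ∈ S, t < T ∧ ∃ w : ℕ, (w : ℝ) < R ∧ HasLowMonic u v t w) ∧
    c * R ^ k / k.factorial ≤ S.card

lemma lowDegreeCount_zero (u v : F[X]) (B : ℝ) : LowDegreeCount u v B 0 1 1 := by
  refine fun R hR _ => ⟨{0}, ?_, by simp⟩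
  simp only [Finset.mem_singleton]
  rintro _ rfl
  exact ⟨one_pos, 0, by simpa using hR, 1, monic_one, natDegree_one, one_mem_baseSpan u 0,
    one_mem_baseSpan v 0⟩

/-- Multiplying by the powers of exponent less than `E` of a further polynomial. -/
lemma LowDegreeCount.exists_finset {u v : F[X]} {B c : ℝ} {k T d : ℕ}
    (h : LowDegreeCount u v B k T c) (hT : HasLowMonic u v T d) (hc : 0 ≤ c) (hd : 0 < d)
    (E : ℕ) {R : ℝ} (hR : 0 < R) (hRB : R ≤ B) : ∃ S : Finset ℕ,
    (∀ t ∈ S, t < T * E ∧ ∃ w : ℕ, (w : ℝ) < R ∧ HasLowMonic u v t w) ∧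
    c / d * (R ^ (k + 1) - (max 0 (R - d * E)) ^ (k + 1)) / (k + 1).factorial ≤ S.card := by
  have hd' : (0 : ℝ) < d := by exact_mod_cast hd
  induction E with
  | zero => exact ⟨∅, by simp, by simp [max_eq_right hR.le]⟩
  | succ E ih =>
    obtain ⟨S, hS, hcard⟩ := ih
    -- When `d * E ≥ R` the weight budget is spent: further powers add nothing, and the truncated
    -- term is already `0`.
    rcases le_or_gt (R - d * E) 0 with hE | hE
    · refine ⟨S, fun t ht => ⟨(hS t ht).1.trans_le (by gcongr; omega), (hS t ht).2⟩, ?_⟩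
      rw [max_eq_left hE] at hcard
      rwa [max_eq_left]
      push_cast
      linarith
    -- Multiplying by the `E`-th power leaves the budget `R - d * E`. The new degrees lie in `[T *
    -- E, T * (E + 1))`, hence are disjoint from the earlier ones.
    · obtain ⟨S', hS', hcard'⟩ := h (R - d * E) hE (by nlinarith [Nat.cast_nonneg (α := ℝ) E])
      have hdisj : Disjoint S (S'.map (addLeftEmbedding (T * E))) := by
        rw [Finset.disjoint_left]
        intro t ht ht'
        obtain ⟨t', _, rfl⟩ := Finset.mem_map.1 ht'
        have := (hS _ ht).1
        simp at this
      refine ⟨S.disjUnion _ hdisj, fun t ht => ?_, ?_⟩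
      · rcases Finset.mem_disjUnion.1 ht with ht | ht
        · exact ⟨(hS t ht).1.trans_le (by gcongr; omega), (hS t ht).2⟩
        · obtain ⟨t', ht', rfl⟩ := Finset.mem_map.1 ht
          obtain ⟨hlt, w, hw, hmon⟩ := hS' t' ht'
          refine ⟨?_, E * d + w, ?_, ?_⟩
          · simp only [addLeftEmbedding_apply, Nat.mul_succ]
            omega
          · push_cast
            linarith
          · have := (hT.pow E).mul hmon
            rwa [mul_comm E T] at this
      · rw [Finset.card_disjUnion, Finset.card_map]
        push_cast
        set x := R - d * E with hx
        have hx' : R - d * ((E : ℝ) + 1) = x - d := by rw [hx]; ring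
        rw [hx']
        rw [max_eq_right hE.le] at hcard
        have hy : max 0 (x - d) ≤ x := max_le hE.le (by linarith)
        have key := pow_succ_sub_pow_succ_le (le_max_left 0 (x - (d : ℝ))) hy k
        have key2 : x ^ (k + 1) - max 0 (x - d) ^ (k + 1) ≤ (k + 1) * d * x ^ k := by
          refine key.trans ?_
          gcongr
          have := le_max_right 0 (x - (d : ℝ))
          linarith
        have hfac : (0 : ℝ) < (k + 1).factorial := by positivity
        -- The slice count dominates the increment of the claimed bound, so the induction
        -- telescopes.
        have key3 : c / d * (x ^ (k + 1) - max 0 (x - d) ^ (k + 1)) / (k + 1).factorial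
            ≤ c * x ^ k / k.factorial := by
          calc c / d * (x ^ (k + 1) - max 0 (x - d) ^ (k + 1)) / (k + 1).factorial
              ≤ c / d * ((k + 1) * d * x ^ k) / (k + 1).factorial := by gcongr
            _ = c * x ^ k / k.factorial := by
              rw [Nat.factorial_succ]
              push_cast
              field_simp
        calc _ = c / d * (R ^ (k + 1) - x ^ (k + 1)) / (k + 1).factorial
              + c / d * (x ^ (k + 1) - max 0 (x - d) ^ (k + 1)) / (k + 1).factorial := by ring
          _ ≤ _ := add_le_add hcard (key3.trans hcard')

/-- With `b` exponents of weight `d` each, `d * b ≥ B ≥ R` exhausts the budget, so the subtracted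
term vanishes and the simplex gains one full dimension. -/
lemma LowDegreeCount.step {u v : F[X]} {B c : ℝ} {k T d b : ℕ}
    (h : LowDegreeCount u v B k T c) (hT : HasLowMonic u v T d) (hc : 0 ≤ c) (hd : 0 < d)
    (hB : B ≤ d * b) : LowDegreeCount u v B (k + 1) (T * b) (c / d) := by
  intro R hR hRB
  obtain ⟨S, hS, hcard⟩ := h.exists_finset hT hc hd b hR hRB
  refine ⟨S, hS, ?_⟩
  rwa [max_eq_left (by linarith), zero_pow (by omega), sub_zero] at hcard

end Counting

/-! ## The explicit polynomials -/

section Explicit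

variable (p m : ℕ) (F : Type*) [Field F] [Fact p.Prime] [CharP F p]

lemma add_one_le_pow_of_prime (hm : 2 ≤ m) : p + 1 < p ^ m := by
  have hp := (Fact.out : p.Prime).two_le
  calc p + 1 < p * p := by nlinarith
    _ = p ^ 2 := by ring
    _ ≤ p ^ m := Nat.pow_le_pow_right (by omega) hm

lemma degree_lowTerms_lt (hm : 2 ≤ m) : (X ^ p + X : F[X]).degree < (p ^ m : ℕ) := by
  have h := add_one_le_pow_of_prime p m hm
  refine (degree_add_le _ _).trans_lt (max_lt ?_ ?_)
  · rw [degree_X_pow]; exact_mod_cast (by omega)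
  · rw [degree_X]; exact_mod_cast (by omega)

lemma monic_rootPoly (hm : 2 ≤ m) : (X ^ p ^ m + X ^ p + X : F[X]).Monic := by
  rw [add_assoc]
  exact monic_X_pow_add (degree_lowTerms_lt p m F hm)

lemma natDegree_rootPoly (hm : 2 ≤ m) : (X ^ p ^ m + X ^ p + X : F[X]).natDegree = p ^ m := by
  rw [add_assoc]
  rw [natDegree_add_eq_left_of_degree_lt, natDegree_X_pow]
  rw [degree_X_pow]
  exact degree_lowTerms_lt p m F hm

lemma pow_pow_rootPoly (i : ℕ) : (X ^ p ^ m + X ^ p + X : F[X]) ^ p ^ i =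
    X ^ (p ^ m * p ^ i) + X ^ (p * p ^ i) + X ^ p ^ i := by
  have : ExpChar F[X] p := ExpChar.prime Fact.out
  rw [add_pow_expChar_pow, add_pow_expChar_pow, pow_mul, pow_mul]

lemma X_pow_mem_baseSpan_scaling {q a t w : ℕ} (hw : a ≤ w) (h : ∃ c, t = a + (q - 1) * c) :
    (X ^ t : F[X]) ∈ baseSpan (X ^ (q - 1)) w := by
  obtain ⟨c, rfl⟩ := h
  rw [pow_add, pow_mul]
  exact X_pow_mul_pow_mem_baseSpan _ hw c

/-- This is `q ≡ 1` modulo `q - 1`: in base `X ^ (q - 1)` a factor `q ^ j` in an exponent costs no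
weight. -/
lemma exists_mul_pow_eq (q a j : ℕ) (hq : 0 < q) : ∃ c, a * q ^ j = a + (q - 1) * c := by
  obtain ⟨c, hc⟩ : q - 1 ∣ q ^ j - 1 := by simpa using Nat.sub_dvd_pow_sub_pow q 1 j
  refine ⟨a * c, ?_⟩
  have : q ^ j = (q - 1) * c + 1 := by
    have := Nat.one_le_pow j q hq
    omega
  rw [this]
  ring

/-- The powers `g ^ (p ^ i * q ^ j)` for `g = X ^ q + X ^ p + X` and `q = p ^ m`. -/
lemma hasLowMonic_rootPoly_pow (hm : 2 ≤ m) (i j w : ℕ) (h1 : p ^ i ≤ w)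
    (h2 : p ^ (i + 1) ≤ w ∨ i + 1 = m ∧ 1 ≤ w) :
    HasLowMonic (X ^ p ^ m + X ^ p + X : F[X]) (X ^ (p ^ m - 1)) ((p ^ m) ^ (j + 1) * p ^ i) w := by
  have hp := (Fact.out : p.Prime).pos
  have hq : 0 < p ^ m := pow_pos hp m
  refine ⟨(X ^ p ^ m + X ^ p + X) ^ p ^ (i + m * j), (monic_rootPoly p m F hm).pow _, ?_, ?_, ?_⟩
  · rw [(monic_rootPoly p m F hm).natDegree_pow, natDegree_rootPoly p m F hm]
    ring
  · simpa using pow_mem_baseSpan (self_mem_baseSpan (X ^ p ^ m + X ^ p + X : F[X]) 0)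
      (p ^ (i + m * j)) |> baseSpan_mono _ (Nat.zero_le w)
  -- Modulo `q - 1` the three exponents become `p ^ i`, `p ^ (i + 1)` and `p ^ i`. For `i + 1 = m`
  -- the middle one is a power of `q` and becomes `1`, which is what the second alternative of `h2`
  -- records.
  · rw [pow_pow_rootPoly]
    refine add_mem (add_mem ?_ ?_) ?_
    · refine X_pow_mem_baseSpan_scaling F h1 ?_
      obtain ⟨c, hc⟩ := exists_mul_pow_eq (p ^ m) (p ^ i) (j + 1) hq
      exact ⟨c, by rw [← hc]; ring⟩
    · rcases h2 with h2 | ⟨rfl, h2⟩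
      · refine X_pow_mem_baseSpan_scaling F h2 ?_
        obtain ⟨c, hc⟩ := exists_mul_pow_eq (p ^ m) (p ^ (i + 1)) j hq
        exact ⟨c, by rw [← hc]; ring⟩
      · refine X_pow_mem_baseSpan_scaling F h2 ?_
        obtain ⟨c, hc⟩ := exists_mul_pow_eq (p ^ (i + 1)) 1 (j + 1) hq
        exact ⟨c, by rw [← hc]; ring⟩
    · refine X_pow_mem_baseSpan_scaling F h1 ?_
      obtain ⟨c, hc⟩ := exists_mul_pow_eq (p ^ m) (p ^ i) j hq
      exact ⟨c, by rw [← hc]; ring⟩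

lemma monic_pow_add_self {f : F[X]} {q : ℕ} (hq : 2 ≤ q) (hf : f.Monic) (hd : 0 < f.natDegree) :
    (f ^ q + f).Monic ∧ (f ^ q + f).natDegree = f.natDegree * q := by
  have hlt : f.degree < (f ^ q).degree := by
    rw [degree_eq_natDegree hf.ne_zero, degree_eq_natDegree (hf.pow q).ne_zero, hf.natDegree_pow]
    exact_mod_cast (by nlinarith : f.natDegree < q * f.natDegree)
  refine ⟨(hf.pow q).add_of_left hlt, ?_⟩
  rw [natDegree_add_eq_left_of_degree_lt hlt, hf.natDegree_pow, mul_comm]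

/-- A monic `q`-linearized polynomial of degree `q ^ m` that is a polynomial in
`X ^ q + X ^ p + X`, for `q = p ^ m`. -/
lemma hasLowMonic_linearized (hm : 2 ≤ m) :
    HasLowMonic (X ^ p ^ m + X ^ p + X : F[X]) (X ^ (p ^ m - 1)) ((p ^ m) ^ m) 1 := by
  have hp := (Fact.out : p.Prime).two_le
  have hq : 2 ≤ p ^ m := by have := add_one_le_pow_of_prime p m hm; omega
  set g : F[X] := X ^ p ^ m + X ^ p + X with hg
  -- With `τ` the `p`-power and `σ = τ ^ m` the `q`-power map, `g = (σ + 1 + τ) X`. Since `σ + 1`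
  -- and `-τ` commute, `(σ + 1) ^ m - (-τ) ^ m` has the right factor `σ + 1 + τ`. Applied to `X` it
  -- is built from `g` by powers and sums; yet `(-τ) ^ m = ± σ`, so only exponents `q ^ j` occur.
  set τ : Module.End ℤ F[X] :=
    (frobenius F[X] p : F[X] →+ F[X]).toIntLinearMap with hτ
  set σ : Module.End ℤ F[X] := τ ^ m with hσ
  have hτ_apply : ∀ f, τ f = f ^ p := fun f => rfl
  have hσ_apply : ∀ f, σ f = f ^ p ^ m := by
    intro f
    have : ∀ k : ℕ, (τ ^ k) f = f ^ p ^ k := by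
      intro k
      induction k with
      | zero => simp
      | succ k ih =>
        rw [pow_succ', Module.End.mul_apply, ih, hτ_apply, ← pow_mul,
          pow_succ]
    exact this m
  have hcomm : Commute (σ + 1) (-τ) :=
    ((Commute.refl τ).pow_left m).neg_right.add_left (Commute.one_left _)
  have hgeom := hcomm.geom_sum₂_mul m
  have hX : ((σ + 1) - (-τ)) X = g := by
    rw [sub_neg_eq_add, LinearMap.add_apply, LinearMap.add_apply, hσ_apply, hτ_apply, hg,
      Module.End.one_apply]
    ring
  have hmon : ∀ j : ℕ, (((σ + 1) ^ j) X).Monic ∧ (((σ + 1) ^ j) X).natDegree = (p ^ m) ^ j := by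
    intro j
    induction j with
    | zero => simp [monic_X]
    | succ j ih =>
      rw [pow_succ', Module.End.mul_apply, LinearMap.add_apply, hσ_apply,
        Module.End.one_apply, pow_succ (p ^ m), ← ih.2]
      exact monic_pow_add_self F hq ih.1 (by rw [ih.2]; positivity)
  have hneg : ((-τ) ^ m) X = (-1 : F[X]) ^ m * X ^ p ^ m := by
    rcases Nat.even_or_odd m with hm' | hm'
    · rw [hm'.neg_pow, hm'.neg_one_pow, ← hσ, hσ_apply, one_mul]
    · rw [hm'.neg_pow, hm'.neg_one_pow, LinearMap.neg_apply, ← hσ, hσ_apply, neg_one_mul]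
  have hlow : ((-τ) ^ m) X ∈ baseSpan (X ^ (p ^ m - 1) : F[X]) 1 ∧
      (((-τ) ^ m) X).natDegree ≤ p ^ m := by
    have hmem : (X ^ p ^ m : F[X]) ∈ baseSpan (X ^ (p ^ m - 1) : F[X]) 1 :=
      X_pow_mem_baseSpan_scaling F le_rfl ⟨1, by omega⟩
    rw [hneg]
    rcases neg_one_pow_eq_or F[X] m with h | h <;> rw [h]
    · simpa using hmem
    · simpa using hmem
  have hdeg : (((-τ) ^ m) X).degree < (((σ + 1) ^ m) X).degree := by
    rw [degree_eq_natDegree (hmon m).1.ne_zero, (hmon m).2]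
    refine degree_le_natDegree.trans_lt ?_
    have : p ^ m < (p ^ m) ^ m := by
      conv_lhs => rw [← pow_one (p ^ m)]
      exact Nat.pow_lt_pow_right (by omega) (by omega)
    exact_mod_cast hlow.2.trans_lt this
  refine ⟨((σ + 1) ^ m - (-τ) ^ m) X, ?_, ?_, ?_, ?_⟩
  · rw [LinearMap.sub_apply]
    exact (hmon m).1.sub_of_left hdeg
  · rw [LinearMap.sub_apply, natDegree_eq_of_degree_eq (degree_sub_eq_left_of_degree_lt hdeg),
      (hmon m).2]
  -- The factored form: the polynomials in `g` are stable under `σ + 1` and `-τ`.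
  · rw [← hgeom, Module.End.mul_apply, hX]
    refine baseSpan_mono g zero_le_one ?_
    have hpow : ∀ f ∈ baseSpan g 0, ∀ k : ℕ, f ^ k ∈ baseSpan g 0 := fun f hf k => by
      simpa using pow_mem_baseSpan hf k
    have hσ_mem : ∀ k : ℕ, ∀ f ∈ baseSpan g 0, ((σ + 1) ^ k) f ∈ baseSpan g 0 := by
      intro k
      induction k with
      | zero => exact fun f hf => hf
      | succ k ih =>
        intro f hf
        rw [pow_succ, Module.End.mul_apply]
        rw [LinearMap.add_apply, hσ_apply, Module.End.one_apply]
        exact ih _ (add_mem (hpow f hf _) hf)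
    have hτ_mem : ∀ k : ℕ, ∀ f ∈ baseSpan g 0, ((-τ) ^ k) f ∈ baseSpan g 0 := by
      intro k
      induction k with
      | zero => exact fun f hf => hf
      | succ k ih =>
        intro f hf
        rw [pow_succ, Module.End.mul_apply]
        refine ih _ (neg_mem ?_)
        exact hpow f hf p
    rw [LinearMap.sum_apply]
    refine sum_mem fun i _ => ?_
    rw [Module.End.mul_apply]
    exact hσ_mem _ _ (hτ_mem _ _ (self_mem_baseSpan g 0))
  · rw [LinearMap.sub_apply]
    refine sub_mem ?_ hlow.1
    -- The expanded form: a `q`-linearized polynomial is `X` times a polynomial in `X ^ (q - 1)`,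
    -- hence of weight `1`.
    have : ∀ k : ℕ, ∃ y ∈ baseSpan (X ^ (p ^ m - 1) : F[X]) 0, ((σ + 1) ^ k) X = X * y := by
      intro k
      induction k with
      | zero => exact ⟨1, one_mem_baseSpan _ _, by simp⟩
      | succ k ih =>
        obtain ⟨y, hy, hk⟩ := ih
        refine ⟨X ^ (p ^ m - 1) * y ^ p ^ m + y, add_mem ?_ hy, ?_⟩
        · simpa using mul_mem_baseSpan (self_mem_baseSpan (X ^ (p ^ m - 1) : F[X]) 0)
            (pow_mem_baseSpan hy (p ^ m))
        · rw [pow_succ', Module.End.mul_apply, hk, LinearMap.add_apply,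
            hσ_apply, Module.End.one_apply, mul_pow, mul_add, ← mul_assoc, ← pow_succ',
            Nat.sub_add_cancel (by omega)]
    obtain ⟨y, hy, hk⟩ := this m
    rw [hk]
    have hX1 : (X : F[X]) ∈ baseSpan (X ^ (p ^ m - 1) : F[X]) 1 := by
      simpa using X_pow_mul_pow_mem_baseSpan (X ^ (p ^ m - 1) : F[X]) (le_refl 1) 0
    have h10 := mul_mem_baseSpan hX1 hy
    rwa [add_zero] at h10

/-- Each increase of `j` adds two generators rather than one, because the powers of `g ^ (q ^ j)`
already use up a budget `q` at exponent `p ^ (m - 1)`, before the degrees up to the next power of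
`q` are covered. The two weights multiply to `q`, whence the constant `q⁻¹ ^ j`. -/
lemma lowDegreeCount_rootPoly (hm : 2 ≤ m) (j : ℕ) :
    LowDegreeCount (X ^ p ^ m + X ^ p + X : F[X]) (X ^ (p ^ m - 1)) ((p : ℝ) ^ m) (2 * j + 1)
      ((p ^ m) ^ (j + 1)) (((p : ℝ) ^ m)⁻¹ ^ j) := by
  have hp := (Fact.out : p.Prime).pos
  have hp' : (0 : ℝ) < p := by exact_mod_cast hp
  induction j with
  | zero =>
    have hX : HasLowMonic (X ^ p ^ m + X ^ p + X : F[X]) (X ^ (p ^ m - 1)) 1 1 :=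
      ⟨X, monic_X, natDegree_X,
        by simpa using X_pow_mul_pow_mem_baseSpan (X ^ p ^ m + X ^ p + X : F[X]) (le_refl 1) 0,
        by simpa using X_pow_mul_pow_mem_baseSpan (X ^ (p ^ m - 1) : F[X]) (le_refl 1) 0⟩
    simpa using (lowDegreeCount_zero (X ^ p ^ m + X ^ p + X : F[X]) (X ^ (p ^ m - 1))
      ((p : ℝ) ^ m)).step (b := p ^ m) hX zero_le_one one_pos (by simp)
  | succ j ih =>
    obtain ⟨k, rfl⟩ : ∃ k, m = k + 1 := ⟨m - 1, by omega⟩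
    -- First `g ^ (q ^ j)`, with `p ^ k` exponents of weight `p`; then `g ^ (p ^ k q ^ j)`, with `p`
    -- exponents of weight `p ^ k`. Both exhaust the budget `q = p ^ (k + 1)`.
    have h1 := hasLowMonic_rootPoly_pow p (k + 1) F hm 0 j p
      (by simpa using Nat.succ_le_of_lt hp) (by simp)
    have h2 := hasLowMonic_rootPoly_pow p (k + 1) F hm k j (p ^ k) le_rfl
      (Or.inr ⟨rfl, Nat.one_le_pow _ _ hp⟩)
    rw [pow_zero, mul_one] at h1
    have h3 := (ih.step (b := p ^ k) h1 (by positivity) hp (by push_cast; rw [pow_succ']))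
    have h4 := h3.step (b := p) h2 (by positivity) (pow_pos hp k) (by push_cast; rw [pow_succ])
    have e1 : (p ^ (k + 1)) ^ (j + 1) * p ^ k * p = (p ^ (k + 1)) ^ (j + 1 + 1) := by ring
    have e2 : ((p : ℝ) ^ (k + 1))⁻¹ ^ j / p / ((p ^ k : ℕ) : ℝ) =
        ((p : ℝ) ^ (k + 1))⁻¹ ^ (j + 1) := by
      push_cast
      rw [div_div, ← pow_succ', pow_succ _ j, div_eq_mul_inv]
    rw [e1, e2] at h4
    exact h4

/-- The number of degrees less than `q ^ m * E` of monic polynomials with digits of degree less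
than `R` in both bases, for `q = p ^ m`. -/
lemma exists_lowDegrees (hm : 2 ≤ m) (E : ℕ) {R : ℝ} (hR : 0 < R) (hRq : R ≤ (p : ℝ) ^ m) :
    ∃ S : Finset ℕ, (∀ t ∈ S, t < (p ^ m) ^ m * E ∧ ∃ w : ℕ, (w : ℝ) < R ∧
      HasLowMonic (X ^ p ^ m + X ^ p + X : F[X]) (X ^ (p ^ m - 1)) t w) ∧
    ((p : ℝ) ^ m)⁻¹ ^ (m - 1) * (R ^ (2 * m) - (max 0 (R - E)) ^ (2 * m)) / (2 * m).factorial
      ≤ S.card := by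
  have h := lowDegreeCount_rootPoly p m F hm (m - 1)
  rw [Nat.sub_add_cancel (by omega)] at h
  obtain ⟨S, hS, hcard⟩ := h.exists_finset (hasLowMonic_linearized p m F hm) (by positivity)
    one_pos E hR hRq
  have e : 2 * (m - 1) + 1 + 1 = 2 * m := by omega
  rw [e] at hcard
  exact ⟨S, hS, by simpa using hcard⟩

end Explicit

/-! ## The affine group generated by translations and scalings -/

section AffineGroup

variable {F : Type*} [Field F]

/-- The additive group spanned by the products `t * s` with `t ∈ V` and `s ∈ U`: the group of
all translations in `affGroup U V`. -/
def scaledSpan (U : AddSubgroup F) (V : Subgroup Fˣ) : AddSubgroup F :=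
  AddSubgroup.closure {x | ∃ t ∈ V, ∃ s ∈ U, x = (t : F) * s}

/-- The affine map `x ↦ t x + b`. -/
noncomputable def affMap (t : Fˣ) (b : F) : F ≃ᵃ[F] F :=
  AffineEquiv.constVAddHom F F (Multiplicative.ofAdd b) *
    AffineEquiv.homothetyUnitsMulHom (0 : F) t

@[simp]
lemma affMap_apply (t : Fˣ) (b x : F) : affMap t b x = t * x + b := by
  simp [affMap, AffineEquiv.mul_def, AffineMap.homothety_apply, add_comm]

variable {U : AddSubgroup F} {V : Subgroup Fˣ}

lemma mem_translationGroup {φ : F ≃ᵃ[F] F} :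
    φ ∈ translationGroup U ↔ ∃ s ∈ U, ∀ x, φ x = x + s := by
  constructor
  · rintro ⟨s, hs, rfl⟩
    exact ⟨s.toAdd, hs, fun x => by simp [add_comm]⟩
  · rintro ⟨s, hs, h⟩
    refine ⟨Multiplicative.ofAdd s, hs, ?_⟩
    ext x
    simp [add_comm, h]

lemma mem_scalingGroup {φ : F ≃ᵃ[F] F} :
    φ ∈ scalingGroup V ↔ ∃ t ∈ V, ∀ x, φ x = (t : F) * x := by
  constructor
  · rintro ⟨t, ht, rfl⟩
    exact ⟨t, ht, fun x => by simp [AffineMap.homothety_apply]⟩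
  · rintro ⟨t, ht, h⟩
    refine ⟨t, ht, ?_⟩
    ext x
    simp [AffineMap.homothety_apply, h]

lemma mul_mem_scaledSpan {t : Fˣ} (ht : t ∈ V) {x : F} (hx : x ∈ scaledSpan U V) :
    (t : F) * x ∈ scaledSpan U V := by
  induction hx using AddSubgroup.closure_induction with
  | mem x hx =>
    obtain ⟨t', ht', s, hs, rfl⟩ := hx
    exact AddSubgroup.subset_closure ⟨t * t', mul_mem ht ht', s, hs, by push_cast; ring⟩
  | zero => simp
  | add x y _ _ hx hy => rw [mul_add]; exact add_mem hx hy
  | neg x _ hx => rw [mul_neg]; exact neg_mem hx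

lemma subset_scaledSpan {s : F} (hs : s ∈ U) : s ∈ scaledSpan U V :=
  AddSubgroup.subset_closure ⟨1, one_mem V, s, hs, by simp⟩

lemma affMap_mul (t t' : Fˣ) (b b' : F) :
    affMap t b * affMap t' b' = affMap (t * t') (t * b' + b) := by
  ext x
  simp [AffineEquiv.mul_def]
  ring

lemma affMap_one_zero : affMap (1 : Fˣ) (0 : F) = 1 := by
  ext x
  simp

lemma affMap_inv (t : Fˣ) (b : F) : (affMap t b)⁻¹ = affMap t⁻¹ (-((t⁻¹ : Fˣ) : F) * b) := by
  rw [inv_eq_iff_mul_eq_one, affMap_mul, mul_inv_cancel, ← affMap_one_zero]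
  congr 1
  simp

lemma affMap_mem_affGroup {t : Fˣ} (ht : t ∈ V) {b : F} (hb : b ∈ scaledSpan U V) :
    affMap t b ∈ affGroup U V := by
  have hscale : ∀ t ∈ V, affMap t (0 : F) ∈ affGroup U V := fun t ht =>
    Subgroup.mem_sup_right (mem_scalingGroup.2 ⟨t, ht, by simp⟩)
  have htrans : ∀ b ∈ scaledSpan U V, affMap (1 : Fˣ) b ∈ affGroup U V := by
    intro b hb
    induction hb using AddSubgroup.closure_induction with
    | mem x hx =>
      obtain ⟨t, ht, s, hs, rfl⟩ := hx
      have h1 : affMap (1 : Fˣ) s ∈ affGroup U V :=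
        Subgroup.mem_sup_left (mem_translationGroup.2 ⟨s, hs, by simp⟩)
      -- Conjugating the translation by `s` with the scaling by `t` gives the translation by `t *
      -- s`.
      have h2 := mul_mem (mul_mem (hscale t ht) h1) (inv_mem (hscale t ht))
      rw [affMap_inv, affMap_mul, affMap_mul] at h2
      simpa using h2
    | zero => rw [affMap_one_zero]; exact one_mem _
    | add x y _ _ hx hy =>
      have := mul_mem hx hy
      rw [affMap_mul] at this
      simpa [add_comm] using this
    | neg x _ hx =>
      have := inv_mem hx
      rw [affMap_inv] at this
      simpa using this
  have := mul_mem (htrans b hb) (hscale t ht)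
  rw [affMap_mul] at this
  simpa using this

/-- `W` is stable under scaling by `V`, so these maps already form a group: the semidirect product
of `W` and `V`. -/
lemma mem_affGroup {φ : F ≃ᵃ[F] F} :
    φ ∈ affGroup U V ↔ ∃ t ∈ V, ∃ b ∈ scaledSpan U V, φ = affMap t b := by
  constructor
  · intro h
    let A : Subgroup (F ≃ᵃ[F] F) :=
      { carrier := {φ | ∃ t ∈ V, ∃ b ∈ scaledSpan U V, φ = affMap t b}
        mul_mem' := by
          rintro _ _ ⟨t, ht, b, hb, rfl⟩ ⟨t', ht', b', hb', rfl⟩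
          exact ⟨t * t', mul_mem ht ht', _, add_mem (mul_mem_scaledSpan ht hb') hb,
            affMap_mul _ _ _ _⟩
        one_mem' := ⟨1, one_mem V, 0, zero_mem _, affMap_one_zero.symm⟩
        inv_mem' := by
          rintro _ ⟨t, ht, b, hb, rfl⟩
          refine ⟨t⁻¹, inv_mem ht, _, ?_, affMap_inv t b⟩
          rw [neg_mul]
          exact neg_mem (mul_mem_scaledSpan (inv_mem ht) hb) }
    have hle : affGroup U V ≤ A := by
      refine sup_le ?_ ?_
      · intro φ hφ
        obtain ⟨s, hs, h⟩ := mem_translationGroup.1 hφ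
        exact ⟨1, one_mem V, s, subset_scaledSpan hs, by ext x; simp [h]⟩
      · intro φ hφ
        obtain ⟨t, ht, h⟩ := mem_scalingGroup.1 hφ
        exact ⟨t, ht, 0, zero_mem _, by ext x; simp [h]⟩
    exact hle h
  · rintro ⟨t, ht, b, hb, rfl⟩
    exact affMap_mem_affGroup ht hb

lemma affMap_injective {t t' : Fˣ} {b b' : F} (h : affMap t b = affMap t' b') :
    t = t' ∧ b = b' := by
  have h0 : b = b' := by simpa using DFunLike.congr_fun h 0
  have h1 : (t : F) + b = t' + b' := by simpa using DFunLike.congr_fun h 1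
  exact ⟨Units.ext (by rw [h0] at h1; exact add_right_cancel h1), h0⟩

/-- The elements of `affGroup U V` are the maps `x ↦ t x + b`. -/
noncomputable def affEquiv (U : AddSubgroup F) (V : Subgroup Fˣ) :
    V × scaledSpan U V ≃ affGroup U V :=
  Equiv.ofBijective (fun x => ⟨affMap x.1 x.2, affMap_mem_affGroup x.1.2 x.2.2⟩) <| by
    constructor
    · rintro ⟨t, b⟩ ⟨t', b'⟩ h
      obtain ⟨h1, h2⟩ := affMap_injective (Subtype.ext_iff.1 h)
      exact Prod.ext (Subtype.ext h1) (Subtype.ext h2)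
    · rintro ⟨φ, hφ⟩
      obtain ⟨t, ht, b, hb, rfl⟩ := mem_affGroup.1 hφ
      exact ⟨(⟨t, ht⟩, ⟨b, hb⟩), rfl⟩

lemma card_affGroup : Nat.card (affGroup U V) = Nat.card (scaledSpan U V) * Nat.card V := by
  rw [← Nat.card_congr (affEquiv U V), Nat.card_prod, mul_comm]

lemma leftEnd_eq_iff {φ ψ : affGroup U V} :
    leftEnd U V φ = leftEnd U V ψ ↔ ∃ s ∈ U, ∀ x, (ψ : F ≃ᵃ[F] F) x = (φ : F ≃ᵃ[F] F) x + s := by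
  refine (Quotient.eq (r := QuotientGroup.rightRel
    ((translationGroup U).subgroupOf (affGroup U V)))).trans ?_
  rw [QuotientGroup.rightRel_apply, Subgroup.mem_subgroupOf, mem_translationGroup]
  refine exists_congr fun s => and_congr_right fun _ => ⟨fun h x => ?_, fun h x => ?_⟩
  · simpa [AffineEquiv.mul_def, AffineEquiv.inv_def] using h ((φ : F ≃ᵃ[F] F) x)
  · simp [AffineEquiv.mul_def, AffineEquiv.inv_def, h]

lemma rightEnd_eq_iff {φ ψ : affGroup U V} :
    rightEnd U V φ = rightEnd U V ψ ↔
      ∃ t ∈ V, ∀ x, (ψ : F ≃ᵃ[F] F) x = (t : F) * (φ : F ≃ᵃ[F] F) x := by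
  refine (Quotient.eq (r := QuotientGroup.rightRel
    ((scalingGroup V).subgroupOf (affGroup U V)))).trans ?_
  rw [QuotientGroup.rightRel_apply, Subgroup.mem_subgroupOf, mem_scalingGroup]
  refine exists_congr fun s => and_congr_right fun _ => ⟨fun h x => ?_, fun h x => ?_⟩
  · simpa [AffineEquiv.mul_def, AffineEquiv.inv_def] using h ((φ : F ≃ᵃ[F] F) x)
  · simp [AffineEquiv.mul_def, AffineEquiv.inv_def, h]

lemma leftEnd_surjective : Function.Surjective (leftEnd U V) := Quotient.mk_surjective

lemma rightEnd_surjective : Function.Surjective (rightEnd U V) := Quotient.mk_surjective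

lemma affMap_one_mul_apply (s : F) (φ : F ≃ᵃ[F] F) (x : F) :
    (affMap 1 s * φ) x = φ x + s := by
  simp [AffineEquiv.mul_def]

lemma affMap_zero_mul_apply (t : Fˣ) (φ : F ≃ᵃ[F] F) (x : F) :
    (affMap t 0 * φ) x = t * φ x := by
  simp [AffineEquiv.mul_def]

/-- The edges at the left endpoint of `φ` are the translates of `φ`. -/
noncomputable def leftFiberEquiv (φ : affGroup U V) :
    U ≃ {ψ : affGroup U V // leftEnd U V ψ = leftEnd U V φ} :=
  Equiv.ofBijective (fun s => ⟨⟨affMap 1 (s : F), affMap_mem_affGroup (one_mem V)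
      (subset_scaledSpan s.2)⟩ * φ, by
        rw [eq_comm, leftEnd_eq_iff]
        exact ⟨s, s.2, affMap_one_mul_apply _ _⟩⟩) <| by
    constructor
    · intro s s' h
      have := mul_right_cancel (Subtype.ext_iff.1 h)
      exact Subtype.ext (affMap_injective (Subtype.ext_iff.1 this)).2
    · rintro ⟨ψ, hψ⟩
      obtain ⟨s, hs, h⟩ := leftEnd_eq_iff.1 hψ.symm
      refine ⟨⟨s, hs⟩, Subtype.ext (Subtype.ext (AffineEquiv.ext fun x => ?_))⟩
      exact (affMap_one_mul_apply _ _ x).trans (h x).symm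

lemma leftFiberEquiv_apply (φ : affGroup U V) (s : U) (x : F) :
    ((leftFiberEquiv φ s : affGroup U V) : F ≃ᵃ[F] F) x = (φ : F ≃ᵃ[F] F) x + s :=
  affMap_one_mul_apply _ _ x

/-- The edges at the right endpoint of `φ` are the multiples of `φ`. -/
noncomputable def rightFiberEquiv (φ : affGroup U V) :
    V ≃ {ψ : affGroup U V // rightEnd U V ψ = rightEnd U V φ} :=
  Equiv.ofBijective (fun t => ⟨⟨affMap (t : Fˣ) (0 : F), affMap_mem_affGroup t.2
      (zero_mem _)⟩ * φ, by
        rw [eq_comm, rightEnd_eq_iff]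
        exact ⟨t, t.2, affMap_zero_mul_apply _ _⟩⟩) <| by
    constructor
    · intro s s' h
      have := mul_right_cancel (Subtype.ext_iff.1 h)
      exact Subtype.ext (affMap_injective (Subtype.ext_iff.1 this)).1
    · rintro ⟨ψ, hψ⟩
      obtain ⟨s, hs, h⟩ := rightEnd_eq_iff.1 hψ.symm
      refine ⟨⟨s, hs⟩, Subtype.ext (Subtype.ext (AffineEquiv.ext fun x => ?_))⟩
      exact (affMap_zero_mul_apply _ _ x).trans (h x).symm

lemma card_leftFiber (v : LeftVertex U V) :
    Nat.card {φ : affGroup U V // leftEnd U V φ = v} = Nat.card U := by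
  obtain ⟨φ, rfl⟩ := leftEnd_surjective v
  exact (Nat.card_congr (leftFiberEquiv φ)).symm

lemma card_rightFiber (v : RightVertex U V) :
    Nat.card {φ : affGroup U V // rightEnd U V φ = v} = Nat.card V := by
  obtain ⟨φ, rfl⟩ := rightEnd_surjective v
  exact (Nat.card_congr (rightFiberEquiv φ)).symm

lemma edgePoint_bijective {α : F} (h : ∀ φ ∈ affGroup U V, φ α = α → φ = 1) :
    Function.Bijective (edgePoint U V α) := by
  constructor
  · intro φ ψ hφψ
    have h1 : (φ : F ≃ᵃ[F] F) α = (ψ : F ≃ᵃ[F] F) α := Subtype.ext_iff.1 hφψ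
    have h2 := h _ (mul_mem (inv_mem ψ.2) φ.2) (by
      simp [AffineEquiv.mul_def, AffineEquiv.inv_def, h1])
    exact (Subtype.ext (inv_mul_eq_one.1 h2)).symm
  · rintro ⟨_, φ, hφ, rfl⟩
    exact ⟨⟨φ, hφ⟩, rfl⟩

end AffineGroup

/-! ## The two groups of the instantiation -/

section Cardinalities

universe u

variable (p m : ℕ) (F : Type u) [Field F] [Fact p.Prime] [CharP F p]

lemma card_roots_of_separable {f : F[X]} (hf : f.Splits) (hs : f.Separable) (hf0 : f ≠ 0) :
    Nat.card {x : F // f.eval x = 0} = f.natDegree := by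
  classical
  rw [hf.natDegree_eq_card_roots, ← Multiset.toFinset_card_of_nodup (nodup_roots hs),
    ← Fintype.card_coe, ← Nat.card_eq_fintype_card]
  refine Nat.card_congr (Equiv.subtypeEquivRight fun x => ?_)
  simp [hf0]

lemma separable_rootPoly (hm : 2 ≤ m) : (X ^ p ^ m + X ^ p + X : F[X]).Separable := by
  rw [separable_def]
  have : derivative (X ^ p ^ m + X ^ p + X : F[X]) = 1 := by
    have hm0 : m ≠ 0 := by omega
    simp [derivative_X_pow, CharP.cast_eq_zero, hm0]
  rw [this]
  exact isCoprime_one_right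

lemma mem_rootGroup {x : F} : x ∈ rootGroup p m F ↔ x ^ p ^ m + x ^ p + x = 0 := Iff.rfl

lemma card_rootGroup (hm : 2 ≤ m) (h : (X ^ p ^ m + X ^ p + X : F[X]).Splits) :
    Nat.card (rootGroup p m F) = p ^ m := by
  rw [← natDegree_rootPoly p m F hm, ← card_roots_of_separable F h (separable_rootPoly p m F hm)
    (monic_rootPoly p m F hm).ne_zero]
  exact Nat.card_congr (Equiv.subtypeEquivRight fun x => by simp [mem_rootGroup])

lemma annihilator_rootGroup (hm : 2 ≤ m) (h : (X ^ p ^ m + X ^ p + X : F[X]).Splits) :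
    annihilator (rootGroup p m F) = X ^ p ^ m + X ^ p + X := by
  classical
  have hmon := monic_rootPoly p m F hm
  set g : F[X] := X ^ p ^ m + X ^ p + X with hg
  have hset : ((rootGroup p m F : AddSubgroup F) : Set F) = (g.roots.toFinset : Set F) := by
    ext x
    have hx : eval x g = x ^ p ^ m + x ^ p + x := by simp [hg]
    simp [mem_rootGroup, hmon.ne_zero, hx]
  calc annihilator (rootGroup p m F)
      = ∏ᶠ x ∈ ((rootGroup p m F : AddSubgroup F) : Set F), (X - C x) :=
        finprod_set_coe_eq_finprod_mem (f := fun x => (X - C x : F[X])) _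
    _ = ∏ x ∈ g.roots.toFinset, (X - C x) := by rw [hset, finprod_mem_coe_finset]
    _ = (g.roots.map fun x => X - C x).prod := by
        rw [Finset.prod, Multiset.toFinset_val,
          Multiset.dedup_eq_self.2 (nodup_roots (separable_rootPoly p m F hm))]
    _ = g := (h.eq_prod_roots_of_monic hmon).symm

/-- The subfield of the elements with `x ^ p ^ m = x`. -/
noncomputable def powFixedField : Subfield F :=
  have : ExpChar F p := ExpChar.prime Fact.out
  RingHom.eqLocusField (iterateFrobenius F p m) (RingHom.id F)

lemma mem_powFixedField {x : F} : x ∈ powFixedField p m F ↔ x ^ p ^ m = x := by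
  have : ExpChar F p := ExpChar.prime Fact.out
  rfl

lemma card_powFixedField (hm : m ≠ 0) (h : (X ^ p ^ m - X : F[X]).Splits) :
    Nat.card (powFixedField p m F) = p ^ m := by
  have hp := (Fact.out : p.Prime).one_lt
  rw [← FiniteField.X_pow_card_pow_sub_X_natDegree_eq F hm hp, ← card_roots_of_separable F h
    (galois_poly_separable p _ (dvd_pow_self p hm))
    (FiniteField.X_pow_card_pow_sub_X_ne_zero F hm hp)]
  exact Nat.card_congr (Equiv.subtypeEquivRight fun x => by
    simp [mem_powFixedField, sub_eq_zero])

lemma mem_subfieldUnits {t : Fˣ} : t ∈ subfieldUnits p m F ↔ t ^ p ^ m = t := Iff.rfl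

lemma mem_subfieldUnits_iff_coe {t : Fˣ} :
    t ∈ subfieldUnits p m F ↔ (t : F) ∈ powFixedField p m F := by
  rw [mem_subfieldUnits, mem_powFixedField, ← Units.val_inj, Units.val_pow_eq_pow_val]

/-- The units of the subfield, as a group of units of the field. -/
noncomputable def powFixedFieldUnits :
    {x : powFixedField p m F // x ≠ 0} ≃ subfieldUnits p m F where
  toFun x := ⟨Units.mk0 (x.1 : F) (fun h => x.2 (Subtype.ext h)),
    (mem_subfieldUnits_iff_coe p m F).2 x.1.2⟩
  invFun t := ⟨⟨(t : Fˣ), (mem_subfieldUnits_iff_coe p m F).1 t.2⟩, fun h =>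
    (t : Fˣ).ne_zero (Subtype.ext_iff.1 h)⟩
  left_inv _ := rfl
  right_inv _ := Subtype.ext (Units.ext rfl)

lemma card_subfieldUnits [Finite F] (hm : m ≠ 0) (h : (X ^ p ^ m - X : F[X]).Splits) :
    Nat.card (subfieldUnits p m F) = p ^ m - 1 := by
  rw [← Nat.card_congr (powFixedFieldUnits p m F), ← card_powFixedField p m F hm h,
    ← Nat.card_units, Nat.card_congr unitsEquivNeZero]

/-- A relation over the field with `p ^ m` elements between roots of `X ^ q + X ^ p + X` that are
linearly independent over the prime field is trivial. -/
lemma eq_zero_of_sum_mul_eq_zero {ι : Type*} [Fintype ι] {v : ι → F} (hm : m ≠ 0)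
    (hv : ∀ i, v i ∈ rootGroup p m F)
    (hind : ∀ a : ι → ℤ, ∑ i, (a i : F) * v i = 0 → ∀ i, (a i : F) = 0)
    (s : Finset ι) : ∀ c : ι → F, (∀ i, c i ^ p ^ m = c i) → (∀ i ∉ s, c i = 0) →
      ∑ i, c i * v i = 0 → ∀ i, c i = 0 := by
  classical
  have : ExpChar F p := ExpChar.prime Fact.out
  have hp := (Fact.out : p.Prime).ne_zero
  -- The `q`-Frobenius fixes the coefficients, and `v ^ p = -v ^ q - v` for roots of `g`; so a
  -- relation among the `v i` is also one among the `v i ^ p`.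
  have hfrob : ∀ c : ι → F, (∀ i, c i ^ p ^ m = c i) → ∑ i, c i * v i = 0 →
      ∑ i, c i * v i ^ p = 0 := by
    intro c hc hsum
    have h1 : ∑ i, c i * v i ^ p ^ m = 0 := by
      have := congrArg (iterateFrobenius F p m) hsum
      simpa [map_sum, iterateFrobenius_def, hc, zero_pow (pow_ne_zero m hp), mul_pow] using this
    have h2 : ∀ i, c i * v i ^ p = -(c i * v i ^ p ^ m) - c i * v i := fun i => by
      linear_combination c i * (mem_rootGroup p m F).1 (hv i)
    simp [h2, Finset.sum_sub_distrib, h1, hsum]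
  induction s using Finset.induction_on with
  | empty => exact fun c _ hs _ i => hs i (by simp)
  | insert j s hj ih =>
    intro c hc hs hsum
    by_cases hcj : c j = 0
    · refine ih c hc (fun i hi => ?_) hsum
      by_cases hij : i = j
      · rw [hij, hcj]
      · exact hs i (by simp [hij, hi])
    exfalso
    -- Normalized so that `c' j = 1`. The `p`-th roots `e` of the coefficients give another relation
    -- with `e j = 1`, so `c' - e` is supported on `s` and vanishes by induction. Thus `c'` has
    -- entries in the prime field, contradicting `hind`.
    set c' : ι → F := fun i => c i / c j with hc'
    have hc'q : ∀ i, c' i ^ p ^ m = c' i := fun i => by simp only [hc', div_pow, hc]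
    have hc'sum : ∑ i, c' i * v i = 0 := by
      simp only [hc', div_mul_eq_mul_div, ← Finset.sum_div, hsum, zero_div]
    set e : ι → F := fun i => c' i ^ p ^ (m - 1) with he
    have hep : ∀ i, e i ^ p = c' i := fun i => by
      rw [he, ← pow_mul, ← pow_succ, Nat.sub_add_cancel (by omega), hc'q]
    have heq : ∀ i, e i ^ p ^ m = e i := fun i => by
      rw [he, ← pow_mul, mul_comm, pow_mul, hc'q]
    have hesum : ∑ i, e i * v i = 0 := by
      have h1 : (∑ i, e i * v i) ^ p = 0 := by
        rw [← frobenius_def, map_sum]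
        simpa [frobenius_def, mul_pow, hep] using hfrob c' hc'q hc'sum
      exact pow_eq_zero_iff hp |>.1 h1
    have hfix : ∀ i, c' i - e i = 0 := by
      refine ih _ (fun i => ?_) (fun i hi => ?_) ?_
      · have := map_sub (iterateFrobenius F p m) (c' i) (e i)
        simpa [iterateFrobenius_def, hc'q, heq] using this
      · by_cases hij : i = j
        · subst hij
          simp [he, hc', hcj]
        · have : c i = 0 := hs i (by simp [hij, hi])
          simp [he, hc', this, hp]
      · simp [sub_mul, Finset.sum_sub_distrib, hc'sum, hesum]
    have hprime : ∀ i, ∃ a : ℤ, (a : F) = c' i := fun i => by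
      rw [← mem_bot_iff_intCast p, Subfield.mem_bot_iff_pow_eq_self]
      nth_rewrite 1 [sub_eq_zero.1 (hfix i)]
      exact hep i
    choose a ha using hprime
    have h0 := hind a (by simpa [ha] using hc'sum) j
    rw [ha] at h0
    simp [hc', hcj] at h0

lemma coe_scaledSpan :
    (scaledSpan (rootGroup p m F) (subfieldUnits p m F) : Set F) =
      (Submodule.span (powFixedField p m F) (rootGroup p m F : Set F) : Set F) := by
  apply Set.Subset.antisymm
  · have : scaledSpan (rootGroup p m F) (subfieldUnits p m F) ≤
        (Submodule.span (powFixedField p m F) (rootGroup p m F : Set F)).toAddSubgroup := by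
      refine (AddSubgroup.closure_le _).2 ?_
      rintro _ ⟨t, ht, s, hs, rfl⟩
      exact Submodule.smul_mem _ (⟨t, (mem_subfieldUnits_iff_coe p m F).1 ht⟩ : powFixedField p m F)
        (Submodule.subset_span hs)
    exact this
  · intro x hx
    induction hx using Submodule.span_induction with
    | mem x hx => exact subset_scaledSpan hx
    | zero => exact zero_mem (scaledSpan _ _)
    | add x y _ _ hx hy => exact add_mem (S := AddSubgroup F) hx hy
    | smul a x _ hx =>
      by_cases ha : (a : F) = 0
      · rw [Subfield.smul_def, ha, zero_smul]
        exact zero_mem (scaledSpan _ _)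
      · exact mul_mem_scaledSpan (t := Units.mk0 (a : F) ha)
          ((mem_subfieldUnits_iff_coe p m F).2 a.2) hx

/-- An `𝔽_p`-basis of `G` has `m` elements and is an `𝔽_q`-basis of its `𝔽_q`-span, which therefore
has `q ^ m` elements. -/
lemma card_scaledSpan [Finite F] (hm : 2 ≤ m) (h : (X ^ p ^ m + X ^ p + X : F[X]).Splits)
    (h' : (X ^ p ^ m - X : F[X]).Splits) :
    Nat.card (scaledSpan (rootGroup p m F) (subfieldUnits p m F)) = p ^ m ^ 2 := by
  let := ZMod.algebra F p
  let U : Submodule (ZMod p) F := AddSubgroup.toZModSubmodule p (rootGroup p m F)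
  have hp := (Fact.out : p.Prime)
  have hU : Module.finrank (ZMod p) U = m := by
    have h1 := Module.natCard_eq_pow_finrank (K := ZMod p) (V := U)
    have h2 : Nat.card U = p ^ m := card_rootGroup p m F hm h
    rw [h2, Nat.card_zmod] at h1
    exact (Nat.pow_right_injective hp.two_le h1).symm
  let b := Module.finBasis (ZMod p) U
  have hind : LinearIndependent (powFixedField p m F) fun i => (b i : F) := by
    rw [Fintype.linearIndependent_iff]
    intro c hc i
    refine Subtype.ext (eq_zero_of_sum_mul_eq_zero p m F (v := fun i => (b i : F)) (by omega)
      (fun i => (b i).2) ?_ Finset.univ (fun i => (c i : F)) (fun i => (c i).2) (by simp) hc i)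
    intro a ha i
    have hb := Fintype.linearIndependent_iff.1 b.linearIndependent (fun i => (a i : ZMod p)) (by
      apply Subtype.ext
      rw [Submodule.coe_sum, Submodule.coe_zero, ← ha]
      refine Finset.sum_congr rfl fun i _ => ?_
      rw [Submodule.coe_smul, Algebra.smul_def, map_intCast]) i
    rw [← map_intCast (algebraMap (ZMod p) F), hb, map_zero]
  have hspan : Submodule.span (powFixedField p m F) (Set.range fun i => (b i : F)) =
      Submodule.span (powFixedField p m F) (rootGroup p m F : Set F) := by
    refine le_antisymm (Submodule.span_mono ?_) (Submodule.span_le.2 ?_)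
    · rintro _ ⟨i, rfl⟩
      exact (b i).2
    · intro x hx
      have hx' := b.sum_repr ⟨x, hx⟩
      have hx'' : ∑ i, b.repr ⟨x, hx⟩ i • (b i : F) = x := by
        have := congrArg U.subtype hx'
        rwa [map_sum] at this
      rw [← hx'']
      refine sum_mem fun i _ => ?_
      obtain ⟨a, ha⟩ := ZMod.intCast_surjective (b.repr ⟨x, hx⟩ i)
      rw [← ha, Algebra.smul_def, map_intCast, ← zsmul_eq_mul]
      exact zsmul_mem (Submodule.subset_span (Set.mem_range_self i)) a
  have hfin : Module.finrank (powFixedField p m F)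
      (Submodule.span (powFixedField p m F) (rootGroup p m F : Set F)) = m := by
    rw [← hspan, finrank_span_eq_card hind, Fintype.card_fin, hU]
  have hcard := Module.natCard_eq_pow_finrank (K := powFixedField p m F)
    (V := Submodule.span (powFixedField p m F) (rootGroup p m F : Set F))
  rw [hfin, card_powFixedField p m F (by omega) h', ← pow_mul, ← sq] at hcard
  rw [← hcard]
  exact Nat.card_congr (Equiv.setCongr (coe_scaledSpan p m F))

lemma card_affGroup_rootGroup [Finite F] (hm : 2 ≤ m)
    (h : (X ^ p ^ m + X ^ p + X : F[X]).Splits) (h' : (X ^ p ^ m - X : F[X]).Splits) :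
    Nat.card (affGroup (rootGroup p m F) (subfieldUnits p m F)) = codeLength p m := by
  rw [card_affGroup, card_scaledSpan p m F hm h h', card_subfieldUnits p m F (by omega) h',
    codeLength]

end Cardinalities

/-! ### Existence of an admissible field and base point -/

section Existence

/-- A point outside the span has trivial stabilizer. -/
lemma eq_one_of_apply_eq_self {p m : ℕ} {F : Type*} [Field F] [Fact p.Prime] [CharP F p] {α : F}
    (hα : α ∉ scaledSpan (rootGroup p m F) (subfieldUnits p m F)) {φ : F ≃ᵃ[F] F}
    (hφ : φ ∈ affGroup (rootGroup p m F) (subfieldUnits p m F)) (h : φ α = α) : φ = 1 := by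
  obtain ⟨t, ht, b, hb, rfl⟩ := mem_affGroup.1 hφ
  rw [affMap_apply] at h
  by_cases ht1 : (t : F) = 1
  · have hb0 : b = 0 := by simpa [ht1] using h
    rw [hb0, Units.val_eq_one.1 ht1, affMap_one_zero]
  -- For `t ≠ 1` the only fixed point is `b / (1 - t)`. It lies in the span, as `1 - t` is again a
  -- unit of `𝔽_q`.
  · refine absurd ?_ hα
    have h1 : (1 : F) - t ≠ 0 := sub_ne_zero.2 (Ne.symm ht1)
    have h2 : α = ((Units.mk0 _ h1)⁻¹ : Fˣ) * b := by
      rw [Units.val_inv_eq_inv_val, Units.val_mk0, eq_inv_mul_iff_mul_eq₀ h1]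
      linear_combination -h
    rw [h2]
    refine mul_mem_scaledSpan (inv_mem ?_) hb
    rw [mem_subfieldUnits_iff_coe] at ht ⊢
    exact sub_mem (one_mem _) ht

lemma exists_admissible (p m : ℕ) [Fact p.Prime] (hm : 2 ≤ m) :
    ∃ (F : Type) (_ : Field F) (_ : Finite F) (_ : CharP F p) (α : F), Admissible p m F α := by
  -- Splitting `X ^ (p ^ N) - X` as well makes the field larger than the span, which has `p ^ (m ^
  -- 2)` elements.
  let N := m ^ 2 + 1
  have hp := (Fact.out : p.Prime)
  let P : (ZMod p)[X] := (X ^ p ^ m + X ^ p + X) * (X ^ p ^ m - X) * (X ^ p ^ N - X)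
  have hP1 := (monic_rootPoly p m (ZMod p) hm).ne_zero
  have hP2 := FiniteField.X_pow_card_pow_sub_X_ne_zero (ZMod p) (by omega : m ≠ 0) hp.one_lt
  have hP3 := FiniteField.X_pow_card_pow_sub_X_ne_zero (ZMod p) (by omega : N ≠ 0) hp.one_lt
  let F := P.SplittingField
  have : CharP F p := charP_of_injective_algebraMap (algebraMap (ZMod p) F).injective p
  have : Finite F := Module.finite_of_finite (ZMod p)
  have hsplit : (P.map (algebraMap (ZMod p) F)).Splits := SplittingField.splits P
  have hP0 : P.map (algebraMap (ZMod p) F) ≠ 0 :=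
    Polynomial.map_ne_zero (mul_ne_zero (mul_ne_zero hP1 hP2) hP3)
  have hmap : P.map (algebraMap (ZMod p) F) =
      (X ^ p ^ m + X ^ p + X) * (X ^ p ^ m - X) * (X ^ p ^ N - X) := by
    simp [P]
  have h1 : (X ^ p ^ m + X ^ p + X : F[X]).Splits :=
    hsplit.of_dvd hP0 (by rw [hmap, mul_assoc]; exact dvd_mul_right _ _)
  have h2 : (X ^ p ^ m - X : F[X]).Splits :=
    hsplit.of_dvd hP0 (by
      rw [hmap, mul_comm (X ^ p ^ m + X ^ p + X : F[X]), mul_assoc]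
      exact dvd_mul_right _ _)
  have h3 : (X ^ p ^ N - X : F[X]).Splits :=
    hsplit.of_dvd hP0 (by rw [hmap]; exact dvd_mul_left _ _)
  have hcard : Nat.card (scaledSpan (rootGroup p m F) (subfieldUnits p m F)) < Nat.card F := by
    rw [card_scaledSpan p m F hm h1 h2]
    calc p ^ m ^ 2 < p ^ N := Nat.pow_lt_pow_right hp.one_lt (Nat.lt_succ_self _)
      _ = Nat.card (powFixedField p N F) := (card_powFixedField p N F (by omega) h3).symm
      _ ≤ Nat.card F := Nat.card_le_card_of_injective _ Subtype.val_injective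
  obtain ⟨α, hα⟩ : ∃ α : F, α ∉ scaledSpan (rootGroup p m F) (subfieldUnits p m F) := by
    by_contra! hall
    refine hcard.ne ?_
    rw [(AddSubgroup.eq_top_iff' _).2 hall]
    exact AddSubgroup.card_top
  exact ⟨F, inferInstance, inferInstance, inferInstance, α, h1, h2,
    fun φ hφ h => eq_one_of_apply_eq_self hα hφ h⟩

end Existence

/-! ## Base degrees and the restrictions to the fibres of the base polynomial -/

section Fibres

variable {F : Type*} [Field F]

/-- The `u`-adic expansion of `f` with `u` replaced by the constant `γ`. -/
noncomputable def specialize (u f : F[X]) (γ : F) : F[X] :=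
  ∑ i ∈ Finset.range (f.natDegree + 1), C (γ ^ i) * baseDigit u i f

lemma eval_specialize {u : F[X]} (hu : 0 < u.natDegree) (f : F[X]) {γ x : F}
    (hx : u.eval x = γ) : (specialize u f γ).eval x = f.eval x := by
  conv_rhs => rw [← sum_baseDigit u hu f _ (Nat.lt_succ_self _)]
  simp [specialize, eval_finsetSum, hx, mul_comm]

lemma degree_specialize_lt {u f : F[X]} {k : ℕ}
    (h : ∀ i, (baseDigit u i f).degree < (k : WithBot ℕ)) (γ : F) :
    (specialize u f γ).degree < (k : WithBot ℕ) := by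
  rw [← mem_degreeLT]
  refine sum_mem fun i _ => ?_
  rw [← smul_eq_C_mul]
  exact Submodule.smul_mem _ _ (mem_degreeLT.2 (h i))

lemma baseDigit_eq_zero_of_degree_lt {u : F[X]} (hu : 0 < u.natDegree) {i : ℕ} {f : F[X]}
    (h : f.degree < (u.natDegree * i : ℕ)) : baseDigit u i f = 0 := by
  have hu0 : u ≠ 0 := by rintro rfl; simp at hu
  induction i generalizing f with
  | zero =>
    have : f = 0 := by
      rw [← degree_eq_bot]
      simpa [Nat.WithBot.lt_zero_iff] using h
    rw [this, baseDigit_zero]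
  | succ i ih =>
    refine ih ?_
    by_cases hlt : f.degree < u.degree
    · rw [(Polynomial.div_eq_zero_iff hu0).2 hlt, degree_zero]
      exact WithBot.bot_lt_coe _
    · have h1 := degree_add_div hu0 (not_lt.1 hlt)
      by_cases h0 : f / u = 0
      · rw [h0, degree_zero]
        exact WithBot.bot_lt_coe _
      rw [← h1, degree_eq_natDegree hu0, degree_eq_natDegree h0] at h
      rw [degree_eq_natDegree h0]
      have h2 : u.natDegree + (f / u).natDegree < u.natDegree * (i + 1) := by exact_mod_cast h
      have h3 : (f / u).natDegree < u.natDegree * i := by rw [mul_add] at h2; omega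
      exact_mod_cast h3

/-- Each fibre of `u` has at most `deg u` points. -/
lemma card_le_natDegree_mul_card_image [DecidableEq F] {u : F[X]} (hu : 0 < u.natDegree)
    (S : Finset F) : S.card ≤ u.natDegree * (S.image fun x => u.eval x).card := by
  refine Finset.card_le_mul_card_image S _ fun γ _ => ?_
  have hne : u - C γ ≠ 0 := fun h => by
    have := natDegree_sub_C (p := u) (a := γ)
    rw [h, natDegree_zero] at this
    omega
  rw [← natDegree_sub_C (p := u) (a := γ)]
  refine le_trans ?_ ((Multiset.toFinset_card_le _).trans (card_roots' (u - C γ)))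
  refine Finset.card_le_card fun x hx => ?_
  simp only [Finset.mem_filter] at hx
  simp [hne, hx.2]

/-- If `deg f < |S|` and `f` agrees with a polynomial of degree `< k` on the fibres of `u` through
the points of `S`, then the `u`-base degree of `f` is `< k`. -/
lemma baseDegree_lt_of_fibres {u f : F[X]} (hu : 0 < u.natDegree) {k : ℕ} (hk : k ≤ u.natDegree)
    (S : Finset F) (hdeg : f.degree < (S.card : WithBot ℕ))
    (hfib : ∀ β ∈ S, ∃ P : F[X], P.degree < (k : WithBot ℕ) ∧ ∃ T : Finset F,
      T.card = u.natDegree ∧ ∀ x ∈ T, u.eval x = u.eval β ∧ f.eval x = P.eval x) :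
    baseDegree u f < (k : WithBot ℕ) := by
  classical
  have hu0 : u ≠ 0 := by rintro rfl; simp at hu
  rw [baseDegree_lt_iff]
  intro i
  rw [degree_lt_iff_coeff_zero]
  intro j hj
  -- For fixed `j ≥ k`, `Q` collects the `j`-th coefficients of all digits. `Q (u β)` is the `j`-th
  -- coefficient of `f` specialized to the fibre of `β`, so it vanishes there; and `deg f < |S|`
  -- makes `deg Q` smaller than the number of fibres met by `S`.
  let Q : F[X] := ∑ i ∈ Finset.range (f.natDegree + 1), monomial i ((baseDigit u i f).coeff j)
  have hQ : ∀ i, Q.coeff i = (baseDigit u i f).coeff j := by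
    intro i
    simp only [Q, finsetSum_coeff, coeff_monomial, Finset.sum_ite_eq', Finset.mem_range]
    split_ifs with hi
    · rfl
    · rw [baseDigit_eq_zero_of_lt u i f (by omega), coeff_zero]
  have hQ0 : Q = 0 := by
    refine eq_zero_of_degree_lt_of_eval_finset_eq_zero (S.image fun x => u.eval x) ?_ ?_
    · rw [degree_lt_iff_coeff_zero]
      intro i hi
      rw [hQ, baseDigit_eq_zero_of_degree_lt hu (hdeg.trans_le ?_), coeff_zero]
      exact_mod_cast (card_le_natDegree_mul_card_image hu S).trans (Nat.mul_le_mul_left _ hi)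
    · intro γ hγ
      obtain ⟨β, hβ, rfl⟩ := Finset.mem_image.1 hγ
      obtain ⟨P, hP, T, hT, hfT⟩ := hfib β hβ
      -- Both have degree below `deg u` and agree on the `deg u` points of the fibre.
      have hsp : specialize u f (u.eval β) = P := by
        refine eq_of_degrees_lt_of_eval_finset_eq T ?_ ?_ fun x hx => ?_
        · rw [hT]
          refine degree_specialize_lt (fun i => ?_) _
          rw [← degree_eq_natDegree hu0]
          exact degree_baseDigit_lt u hu i f
        · rw [hT]
          exact hP.trans_le (by exact_mod_cast hk)
        · rw [eval_specialize hu f (hfT x hx).1, (hfT x hx).2]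
      have hcoeff : (specialize u f (u.eval β)).coeff j = Q.eval (u.eval β) := by
        simp only [specialize, Q, finsetSum_coeff, eval_finsetSum, coeff_C_mul, eval_monomial]
        exact Finset.sum_congr rfl fun _ _ => mul_comm _ _
      rw [← hcoeff, hsp]
      exact coeff_eq_zero_of_degree_lt (hP.trans_le (by exact_mod_cast hj))
  rw [← hQ, hQ0, coeff_zero]

end Fibres

/-! ## The evaluation code and the Tanner code -/

lemma mem_rsCode {F : Type*} [Field F] {ι : Type*} {x : ι → F} {k : ℕ} {c : ι → F} :
    c ∈ rsCode x k ↔ ∃ P : F[X], P.degree < (k : WithBot ℕ) ∧ ∀ i, c i = P.eval (x i) := by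
  simp only [rsCode, Submodule.mem_map, mem_degreeLT]
  refine exists_congr fun P => and_congr_right fun _ => ⟨?_, fun h => ?_⟩
  · rintro rfl i
    rfl
  · ext i
    exact (h i).symm

section Tanner

variable {F : Type*} [Field F] [Finite F] {U : AddSubgroup F} {V : Subgroup Fˣ}

lemma natDegree_annihilator : (annihilator U).natDegree = Nat.card U := by
  have := Fintype.ofFinite U
  rw [annihilator, finprod_eq_prod_of_fintype, natDegree_prod_of_monic _ _ fun i _ =>
    monic_X_sub_C _]
  simp

lemma eval_annihilator_add {s : F} (hs : s ∈ U) (x : F) :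
    (annihilator U).eval (x + s) = (annihilator U).eval x := by
  have := Fintype.ofFinite U
  rw [annihilator, finprod_eq_prod_of_fintype, eval_prod, eval_prod]
  refine Fintype.prod_equiv (Equiv.subRight (⟨s, hs⟩ : U)) _ _ fun y => ?_
  simp only [eval_sub, eval_X, eval_C, Equiv.subRight_apply, AddSubgroup.coe_sub]
  ring

lemma natDegree_scalingInvariant : (scalingInvariant V : F[X]).natDegree = Nat.card V :=
  natDegree_X_pow _

lemma eval_scalingInvariant_mul {t : Fˣ} (ht : t ∈ V) (x : F) :
    (scalingInvariant V).eval ((t : F) * x) = (scalingInvariant V).eval x := by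
  have h : t ^ Nat.card V = 1 :=
    Subtype.ext_iff.1 (pow_card_eq_one' (x := (⟨t, ht⟩ : V)))
  rw [scalingInvariant, eval_pow, eval_pow, eval_X, mul_pow, ← Units.val_pow_eq_pow_val, h,
    Units.val_one, one_mul, eval_X]

lemma mem_code {α : F} {r : ℝ} {D : ℕ} {c : Omega U V α → F} :
    c ∈ code U V α r D ↔ ∃ f ∈ messageSpace U V r D, ∀ x, c x = f.eval (x : F) := by
  simp only [code, Submodule.mem_map]
  refine exists_congr fun P => and_congr_right fun _ => ⟨?_, fun h => ?_⟩
  · rintro rfl i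
    rfl
  · ext i
    exact (h i).symm

lemma mem_codeOnEdges {α : F} {r : ℝ} {D : ℕ} {c : affGroup U V → F} :
    c ∈ codeOnEdges U V α r D ↔
      ∃ f ∈ messageSpace U V r D, ∀ φ : affGroup U V, c φ = f.eval ((φ : F ≃ᵃ[F] F) α) := by
  constructor
  · rintro ⟨c', hc', rfl⟩
    obtain ⟨f, hf, h⟩ := mem_code.1 hc'
    exact ⟨f, hf, fun φ => h _⟩
  · rintro ⟨f, hf, h⟩
    exact ⟨fun x => f.eval (x : F), mem_code.2 ⟨f, hf, fun _ => rfl⟩, funext fun φ => (h φ).symm⟩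

lemma eval_annihilator_of_leftEnd_eq (α : F) {φ ψ : affGroup U V}
    (h : leftEnd U V φ = leftEnd U V ψ) :
    (annihilator U).eval ((ψ : F ≃ᵃ[F] F) α) = (annihilator U).eval ((φ : F ≃ᵃ[F] F) α) := by
  obtain ⟨s, hs, h⟩ := leftEnd_eq_iff.1 h
  rw [h, eval_annihilator_add hs]

lemma eval_scalingInvariant_of_rightEnd_eq (α : F) {φ ψ : affGroup U V}
    (h : rightEnd U V φ = rightEnd U V ψ) :
    (scalingInvariant V).eval ((ψ : F ≃ᵃ[F] F) α) =
      (scalingInvariant V).eval ((φ : F ≃ᵃ[F] F) α) := by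
  obtain ⟨s, hs, h⟩ := rightEnd_eq_iff.1 h
  rw [h, eval_scalingInvariant_mul hs]

/-- The invariant polynomial is constant on the edges at a vertex, so there `f` coincides with its
specialization, whose degree is bounded by the base degree of `f`. -/
lemma codeOnEdges_le (α : F) (r : ℝ) (D : ℕ) :
    codeOnEdges U V α r D ≤ cosetTannerCode U V α r := by
  intro c hc
  obtain ⟨f, ⟨-, hg, hh⟩, hcf⟩ := mem_codeOnEdges.1 hc
  rw [baseDegree_lt_iff] at hg hh
  refine ⟨fun v => ?_, fun v => ?_⟩
  · obtain ⟨φ, rfl⟩ := leftEnd_surjective v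
    refine mem_rsCode.2 ⟨_, degree_specialize_lt hg
      ((annihilator U).eval ((φ : F ≃ᵃ[F] F) α)), fun ψ => ?_⟩
    refine (hcf _).trans (eval_specialize ?_ f ?_).symm
    · rw [natDegree_annihilator]
      exact Nat.card_pos
    · exact eval_annihilator_of_leftEnd_eq α ψ.2.symm
  · obtain ⟨φ, rfl⟩ := rightEnd_surjective v
    refine mem_rsCode.2 ⟨_, degree_specialize_lt hh
      ((scalingInvariant V).eval ((φ : F ≃ᵃ[F] F) α)), fun ψ => ?_⟩
    refine (hcf _).trans (eval_specialize ?_ f ?_).symm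
    · rw [natDegree_scalingInvariant]
      exact Nat.card_pos
    · exact eval_scalingInvariant_of_rightEnd_eq α ψ.2.symm

lemma ceil_mul_natCast_le {r : ℝ} (hr : r ≤ 1) (n : ℕ) : ⌈r * n⌉₊ ≤ n :=
  Nat.ceil_le.2 (mul_le_of_le_one_left (Nat.cast_nonneg n) hr)

/-- The code without a degree restriction is the whole Tanner code. -/
lemma codeOnEdges_eq {α : F} (hα : ∀ φ ∈ affGroup U V, φ α = α → φ = 1) {r : ℝ} (hr : r ≤ 1) :
    codeOnEdges U V α r (Nat.card (affGroup U V)) = cosetTannerCode U V α r := by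
  classical
  refine le_antisymm (codeOnEdges_le α r _) fun c hc => ?_
  have := Fintype.ofFinite (affGroup U V)
  let pt : affGroup U V → F := fun φ => (φ : F ≃ᵃ[F] F) α
  have hpt : Function.Injective pt := fun φ ψ h =>
    (edgePoint_bijective hα).1 (Subtype.ext h)
  let f := Lagrange.interpolate Finset.univ pt c
  have hfdeg : f.degree < (Nat.card (affGroup U V) : WithBot ℕ) := by
    rw [Nat.card_eq_fintype_card]
    exact Lagrange.degree_interpolate_lt c hpt.injOn
  have hf : ∀ φ, f.eval (pt φ) = c φ := fun φ =>
    Lagrange.eval_interpolate_at_node c hpt.injOn (Finset.mem_univ φ)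
  have hcard : (Finset.univ.image pt).card = Nat.card (affGroup U V) := by
    rw [Finset.card_image_of_injective _ hpt, Finset.card_univ, Nat.card_eq_fintype_card]
  refine mem_codeOnEdges.2 ⟨f, ⟨hfdeg, ?_, ?_⟩, fun φ => (hf φ).symm⟩
  · refine baseDegree_lt_of_fibres (natDegree_annihilator (U := U) ▸ Nat.card_pos)
      (natDegree_annihilator (U := U) ▸ ceil_mul_natCast_le hr _) (Finset.univ.image pt)
      (by rwa [hcard]) fun β hβ => ?_
    obtain ⟨φ, -, rfl⟩ := Finset.mem_image.1 hβ
    obtain ⟨P, hP, hcP⟩ := mem_rsCode.1 (hc.1 (leftEnd U V φ))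
    refine ⟨P, hP, (Finset.univ.filter fun ψ => leftEnd U V ψ = leftEnd U V φ).image pt, ?_, ?_⟩
    · rw [Finset.card_image_of_injective _ hpt, natDegree_annihilator,
        ← card_leftFiber (leftEnd U V φ), Nat.card_eq_fintype_card, Fintype.card_subtype]
    · intro x hx
      obtain ⟨ψ, hψ, rfl⟩ := Finset.mem_image.1 hx
      have hψ' := (Finset.mem_filter.1 hψ).2
      exact ⟨eval_annihilator_of_leftEnd_eq α hψ'.symm, (hf ψ).trans (hcP ⟨ψ, hψ'⟩)⟩
  · refine baseDegree_lt_of_fibres (natDegree_scalingInvariant (V := V) ▸ Nat.card_pos)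
      (natDegree_scalingInvariant (V := V) ▸ ceil_mul_natCast_le hr _) (Finset.univ.image pt)
      (by rwa [hcard]) fun β hβ => ?_
    obtain ⟨φ, -, rfl⟩ := Finset.mem_image.1 hβ
    obtain ⟨P, hP, hcP⟩ := mem_rsCode.1 (hc.2 (rightEnd U V φ))
    refine ⟨P, hP, (Finset.univ.filter fun ψ => rightEnd U V ψ = rightEnd U V φ).image pt, ?_, ?_⟩
    · rw [Finset.card_image_of_injective _ hpt, natDegree_scalingInvariant,
        ← card_rightFiber (rightEnd U V φ), Nat.card_eq_fintype_card, Fintype.card_subtype]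
    · intro x hx
      obtain ⟨ψ, hψ, rfl⟩ := Finset.mem_image.1 hx
      have hψ' := (Finset.mem_filter.1 hψ).2
      exact ⟨eval_scalingInvariant_of_rightEnd_eq α hψ'.symm, (hf ψ).trans (hcP ⟨ψ, hψ'⟩)⟩

end Tanner

/-! ## Fourier analysis on a finite abelian group -/

section Fourier

variable {W : Type*} [AddCommGroup W] [Fintype W]

/-- The (unnormalized) Fourier coefficient of `f` at `χ`. -/
noncomputable def fourierCoeff (f : W → ℂ) (χ : AddChar W ℂ) : ℂ := ∑ w, f w * χ w

/-- Parseval: expand the square and use orthogonality in the sum over characters. -/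
lemma sum_norm_sq_fourierCoeff (f : W → ℂ) :
    ∑ χ : AddChar W ℂ, ‖fourierCoeff f χ‖ ^ 2 = Fintype.card W * ∑ w, ‖f w‖ ^ 2 := by
  classical
  have h : ∀ χ : AddChar W ℂ, ((‖fourierCoeff f χ‖ ^ 2 : ℝ) : ℂ) =
      ∑ w, ∑ w', f w * (starRingEnd ℂ) (f w') * χ (w - w') := by
    intro χ
    push_cast
    rw [← Complex.mul_conj', fourierCoeff, map_sum, Finset.sum_mul_sum]
    refine Finset.sum_congr rfl fun w _ => Finset.sum_congr rfl fun w' _ => ?_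
    rw [map_mul, sub_eq_add_neg, AddChar.map_add_eq_mul, AddChar.map_neg_eq_conj]
    ring
  have h2 : ((∑ χ : AddChar W ℂ, ‖fourierCoeff f χ‖ ^ 2 : ℝ) : ℂ) =
      ((Fintype.card W * ∑ w, ‖f w‖ ^ 2 : ℝ) : ℂ) := by
    rw [Complex.ofReal_sum]
    simp_rw [h]
    rw [Finset.sum_comm]
    simp_rw [Finset.sum_comm (s := (Finset.univ : Finset (AddChar W ℂ))), ← Finset.mul_sum,
      AddChar.sum_apply_eq_ite, sub_eq_zero]
    simp only [mul_ite, mul_zero, Finset.sum_ite_eq, Finset.mem_univ, if_true, Complex.mul_conj']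
    push_cast
    rw [Finset.mul_sum]
    exact Finset.sum_congr rfl fun _ _ => mul_comm _ _
  exact_mod_cast h2

variable {U T : Type*} [AddCommGroup U] [Fintype U] [Fintype T]

/-- Summing over translates multiplies a Fourier coefficient by a character sum over `U`, which is
`|U|` or `0`. -/
lemma fourierCoeff_sum_translate (f : W → ℂ) (S : U →+ W) (χ : AddChar W ℂ)
    [Decidable (∀ s, χ (S s) = 1)] :
    fourierCoeff (fun w => ∑ s, f (w + S s)) χ =
      if ∀ s, χ (S s) = 1 then fourierCoeff f χ * Fintype.card U else 0 := by
  classical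
  have h1 : fourierCoeff (fun w => ∑ s, f (w + S s)) χ =
      fourierCoeff f χ * ∑ s, (χ.compAddMonoidHom S) s := by
    have h0 : fourierCoeff (fun w => ∑ s, f (w + S s)) χ = ∑ s, ∑ w, f (w + S s) * χ w := by
      simp only [fourierCoeff, Finset.sum_mul]
      exact Finset.sum_comm
    -- Translation by `S s` contributes the factor `χ (S (-s))`; reindexing by `-s` removes the
    -- sign.
    rw [h0, Finset.mul_sum, ← Equiv.sum_comp (Equiv.neg U)
      (fun s => fourierCoeff f χ * (χ.compAddMonoidHom S) s)]
    refine Finset.sum_congr rfl fun s _ => ?_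
    simp only [fourierCoeff, Finset.sum_mul]
    rw [← Equiv.sum_comp (Equiv.addRight (S s)) (fun w => f w * χ w *
      (χ.compAddMonoidHom S) (Equiv.neg U s))]
    refine Finset.sum_congr rfl fun w _ => ?_
    have h2 : χ w = χ (w + S s) * χ (S (-s)) := by
      rw [← AddChar.map_add_eq_mul, map_neg, add_neg_cancel_right]
    rw [h2, mul_assoc]
    rfl
  rw [h1, AddChar.sum_eq_ite]
  have h2 : χ.compAddMonoidHom S = 0 ↔ ∀ s, χ (S s) = 1 := by
    rw [DFunLike.ext_iff]
    simp [AddChar.compAddMonoidHom_apply]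
  simp only [h2, mul_ite, mul_zero]

/-- The averages over the cosets of the groups `S t (U)` contract the functions of mean zero, if
few of these groups lie in the kernel of a given non-trivial character. -/
lemma sum_norm_sq_translates_le (S : T → U →+ W) {N : ℕ}
    (hN : ∀ χ : AddChar W ℂ, χ ≠ 0 → Nat.card {t // ∀ s, χ (S t s) = 1} ≤ N)
    (f : W → ℂ) (hf : ∑ w, f w = 0) :
    ∑ t, ∑ w, ‖∑ s, f (w + S t s)‖ ^ 2 ≤ (Fintype.card U : ℝ) ^ 2 * N * ∑ w, ‖f w‖ ^ 2 := by
  classical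
  have hW : (0 : ℝ) < Fintype.card W := by exact_mod_cast Fintype.card_pos
  refine le_of_mul_le_mul_left ?_ hW
  calc (Fintype.card W : ℝ) * ∑ t, ∑ w, ‖∑ s, f (w + S t s)‖ ^ 2
      = ∑ χ : AddChar W ℂ, ∑ t, ‖fourierCoeff (fun w => ∑ s, f (w + S t s)) χ‖ ^ 2 := by
        rw [Finset.mul_sum, Finset.sum_comm]
        exact Finset.sum_congr rfl fun t _ => (sum_norm_sq_fourierCoeff _).symm
    _ ≤ ∑ χ : AddChar W ℂ, (Fintype.card U : ℝ) ^ 2 * N * ‖fourierCoeff f χ‖ ^ 2 := by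
        refine Finset.sum_le_sum fun χ _ => ?_
        by_cases hχ : χ = 0
        · have h0 : fourierCoeff f χ = 0 := by simpa [hχ, fourierCoeff] using hf
          simp [fourierCoeff_sum_translate, h0]
        · have h1 : ∀ t, ‖fourierCoeff (fun w => ∑ s, f (w + S t s)) χ‖ ^ 2 =
              if ∀ s, χ (S t s) = 1 then (Fintype.card U : ℝ) ^ 2 * ‖fourierCoeff f χ‖ ^ 2
              else 0 := fun t => by
            rw [fourierCoeff_sum_translate]
            split_ifs
            · simp [mul_pow, mul_comm]
            · simp
          simp only [h1]
          rw [← Finset.sum_filter, Finset.sum_const, nsmul_eq_mul, ← Fintype.card_subtype,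
            ← Nat.card_eq_fintype_card]
          have h2 : (Nat.card {t // ∀ s, χ (S t s) = 1} : ℝ) ≤ N := by exact_mod_cast hN χ hχ
          calc _ ≤ (N : ℝ) * ((Fintype.card U : ℝ) ^ 2 * ‖fourierCoeff f χ‖ ^ 2) := by gcongr
            _ = _ := by ring
    _ = (Fintype.card W : ℝ) * ((Fintype.card U : ℝ) ^ 2 * N * ∑ w, ‖f w‖ ^ 2) := by
        rw [← Finset.mul_sum, sum_norm_sq_fourierCoeff]
        ring

end Fourier

/-! ## The second singular value of a bipartite graph -/

section SingularValue

variable {E L R : Type*} [Fintype E] [Fintype L] [Fintype R] [DecidableEq L]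

lemma biadjacency_mulVec (left : E → L) (right : E → R) (f : R → ℂ) (v : L) :
    (biadjacency left right).mulVec f v = ∑ e with left e = v, f (right e) := by
  classical
  simp only [Matrix.mulVec, dotProduct, biadjacency, Nat.card_eq_fintype_card,
    Fintype.card_subtype]
  rw [← Finset.sum_fiberwise _ right]
  refine Finset.sum_congr rfl fun w _ => ?_
  rw [Finset.filter_filter, Finset.sum_congr rfl (g := fun _ => f w), Finset.sum_const,
    nsmul_eq_mul]
  intro e he
  rw [(Finset.mem_filter.1 he).2.2]

lemma secondSingularValue_le (left : E → L) (right : E → R) {dL dR : ℕ} (hL : 0 < dL)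
    (hR : 0 < dR) {μ : ℝ}
    (h : ∀ f : R → ℂ, ∑ w, f w = 0 →
      ∑ v, ‖∑ e with left e = v, f (right e)‖ ^ 2 ≤ μ * (dL * dR) * ∑ w, ‖f w‖ ^ 2) :
    secondSingularValue left right dL dR ≤ Real.sqrt μ := by
  -- Nonnegativity of the bound also covers an empty set of test vectors, whose supremum is `0` by
  -- convention.
  refine Real.sSup_le ?_ (Real.sqrt_nonneg _)
  rintro s ⟨f, hf1, hf0, rfl⟩
  have hd : (0 : ℝ) < dL * dR := by positivity
  have hsum : ∑ w, f w = 0 := by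
    simpa [PiLp.inner_apply] using hf0
  have hnorm : ∑ w, ‖f w‖ ^ 2 = 1 := by
    rw [← EuclideanSpace.norm_sq_eq, hf1, one_pow]
  have key := h f hsum
  rw [hnorm, mul_one] at key
  refine Real.le_sqrt_of_sq_le ?_
  rw [WithLp.toLp_smul, norm_smul, mul_pow, EuclideanSpace.norm_sq_eq, Complex.norm_real,
    Real.norm_eq_abs, sq_abs, inv_pow, Real.sq_sqrt hd.le, inv_mul_le_iff₀ hd]
  simp only [biadjacency_mulVec]
  linarith

end SingularValue

/-! ## The spectral bound for the coset graph -/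

section CosetGraph

variable {F : Type*} [Field F] {U : AddSubgroup F} {V : Subgroup Fˣ}

/-- The map `x ↦ t (x + w)` as an edge of the coset graph. -/
noncomputable def cosetEquiv (U : AddSubgroup F) (V : Subgroup Fˣ) :
    V × scaledSpan U V ≃ affGroup U V :=
  (Equiv.ofBijective (fun x : V × scaledSpan U V =>
    ((x.1, ⟨((x.1 : Fˣ) : F) * x.2, mul_mem_scaledSpan x.1.2 x.2.2⟩) : V × scaledSpan U V)) <| by
    constructor
    · rintro ⟨t, w⟩ ⟨t', w'⟩ h
      obtain ⟨rfl, h2⟩ := Prod.ext_iff.1 h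
      exact Prod.ext rfl (Subtype.ext (mul_left_cancel₀ (t : Fˣ).ne_zero (Subtype.ext_iff.1 h2)))
    · rintro ⟨t, w⟩
      refine ⟨(t, ⟨(((t : Fˣ)⁻¹ : Fˣ) : F) * w, mul_mem_scaledSpan (inv_mem t.2) w.2⟩), ?_⟩
      exact Prod.ext rfl (Subtype.ext (by simp))).trans (affEquiv U V)

lemma cosetEquiv_apply (t : V) (w : scaledSpan U V) (x : F) :
    (cosetEquiv U V (t, w) : F ≃ᵃ[F] F) x = ((t : Fˣ) : F) * (x + w) := by
  rw [mul_add]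
  exact affMap_apply _ _ _

lemma rightEnd_cosetEquiv (t : V) (w : scaledSpan U V) :
    rightEnd U V (cosetEquiv U V (t, w)) = rightEnd U V (cosetEquiv U V (1, w)) := by
  rw [eq_comm, rightEnd_eq_iff]
  exact ⟨t, t.2, fun x => by simp [cosetEquiv_apply]⟩

/-- The right vertices correspond to the translations. -/
noncomputable def rightVertexEquiv (U : AddSubgroup F) (V : Subgroup Fˣ) :
    scaledSpan U V ≃ RightVertex U V :=
  Equiv.ofBijective (fun w => rightEnd U V (cosetEquiv U V (1, w))) <| by
    constructor
    · intro w w' h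
      obtain ⟨t, -, h⟩ := rightEnd_eq_iff.1 h
      have h0 := h 0
      have h1 := h 1
      simp only [cosetEquiv_apply, OneMemClass.coe_one, Units.val_one, one_mul, zero_add] at h0 h1
      have ht : (t : F) = 1 := by linear_combination h0 - h1
      rw [ht, one_mul] at h0
      exact Subtype.ext h0.symm
    · intro v
      obtain ⟨φ, rfl⟩ := rightEnd_surjective v
      obtain ⟨⟨t, w⟩, rfl⟩ := (cosetEquiv U V).surjective φ
      exact ⟨w, (rightEnd_cosetEquiv t w).symm⟩

/-- Multiplication by `t⁻¹`, as a map from `U` to the group of translations. -/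
def scaleHom (U : AddSubgroup F) (V : Subgroup Fˣ) (t : V) : U →+ scaledSpan U V where
  toFun s := ⟨(((t : Fˣ)⁻¹ : Fˣ) : F) * s,
    mul_mem_scaledSpan (inv_mem t.2) (subset_scaledSpan s.2)⟩
  map_zero' := Subtype.ext (mul_zero _)
  map_add' _ _ := Subtype.ext (mul_add _ _ _)

/-- `t (x + w) + s = t (x + w + t⁻¹ s)`: in the coordinates `(t, w)`, the left vertex is the coset
of `w` modulo `t⁻¹ U`, while the right vertex depends on `w` alone. -/
lemma leftFiberEquiv_cosetEquiv (t : V) (w : scaledSpan U V) (s : U) :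
    (leftFiberEquiv (cosetEquiv U V (t, w)) s : affGroup U V) =
      cosetEquiv U V (t, w + scaleHom U V t s) := by
  refine Subtype.ext (AffineEquiv.ext fun x => ?_)
  rw [leftFiberEquiv_apply, cosetEquiv_apply, cosetEquiv_apply]
  simp only [scaleHom, AddMonoidHom.coe_mk, ZeroHom.coe_mk, AddSubgroup.coe_add, mul_add,
    Units.mul_inv_cancel_left]
  ring

variable [Finite F]

lemma sum_norm_sq_leftVertex_le [Fintype (affGroup U V)] [DecidableEq (LeftVertex U V)] {N : ℕ}
    (hN : ∀ χ : AddChar (scaledSpan U V) ℂ, χ ≠ 0 →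
      Nat.card {t : V // ∀ s, χ (scaleHom U V t s) = 1} ≤ N)
    (f : RightVertex U V → ℂ) (hf : ∑ w, f w = 0) :
    ∑ v, ‖∑ φ with leftEnd U V φ = v, f (rightEnd U V φ)‖ ^ 2 ≤
      (Nat.card U : ℝ) * N * ∑ w, ‖f w‖ ^ 2 := by
  classical
  have := Fintype.ofFinite U
  have := Fintype.ofFinite V
  have := Fintype.ofFinite (scaledSpan U V)
  have hU : (0 : ℝ) < Nat.card U := by exact_mod_cast Nat.card_pos
  set S : LeftVertex U V → ℂ := fun v => ∑ φ with leftEnd U V φ = v, f (rightEnd U V φ) with hS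
  set g : scaledSpan U V → ℂ := fun w => f (rightVertexEquiv U V w) with hg
  have hsum : ∀ h : RightVertex U V → ℝ, ∑ w, h (rightVertexEquiv U V w) = ∑ v, h v := fun h =>
    Equiv.sum_comp _ h
  have hg0 : ∑ w, g w = 0 := (Equiv.sum_comp (rightVertexEquiv U V) f).trans hf
  have hright : ∀ t w, f (rightEnd U V (cosetEquiv U V (t, w))) = g w := fun t w => by
    rw [rightEnd_cosetEquiv]
    rfl
  have hSφ : ∀ t w, S (leftEnd U V (cosetEquiv U V (t, w))) =
      ∑ s, g (w + scaleHom U V t s) := by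
    intro t w
    simp only [hS]
    rw [Finset.sum_subtype (p := fun φ => leftEnd U V φ = leftEnd U V (cosetEquiv U V (t, w))) _
      (by simp), ← Equiv.sum_comp (leftFiberEquiv (cosetEquiv U V (t, w)))]
    exact Finset.sum_congr rfl fun s _ => by rw [leftFiberEquiv_cosetEquiv, hright]
  -- Summing over edges counts each left vertex `|U|` times; this cancels one of the two factors
  -- `|U|` in the Fourier bound.
  have hleft : (Nat.card U : ℝ) * ∑ v, ‖S v‖ ^ 2 = ∑ φ, ‖S (leftEnd U V φ)‖ ^ 2 := by
    rw [← Finset.sum_fiberwise _ (leftEnd U V), Finset.mul_sum]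
    refine Finset.sum_congr rfl fun v _ => ?_
    rw [Finset.sum_congr rfl (g := fun _ => ‖S v‖ ^ 2) fun φ hφ => by
      rw [(Finset.mem_filter.1 hφ).2], Finset.sum_const, nsmul_eq_mul, ← card_leftFiber v,
      Nat.card_eq_fintype_card, Fintype.card_subtype]
  have hprod : ∑ φ, ‖S (leftEnd U V φ)‖ ^ 2 =
      ∑ t, ∑ w, ‖∑ s, g (w + scaleHom U V t s)‖ ^ 2 := by
    rw [← Equiv.sum_comp (cosetEquiv U V), Fintype.sum_prod_type]
    simp only [hSφ]
  have key := sum_norm_sq_translates_le (scaleHom U V) hN g hg0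
  rw [← hprod, ← hleft, hsum (fun v => ‖f v‖ ^ 2), ← Nat.card_eq_fintype_card] at key
  refine le_of_mul_le_mul_left ?_ hU
  calc _ ≤ _ := key
    _ = _ := by ring

end CosetGraph

/-! ## The spectral bound for the instantiation -/

section Instance

variable (p m : ℕ) {F : Type*} [Field F] [Fact p.Prime] [CharP F p] [Finite F]

/-- A non-trivial character is trivial on few of the groups `t⁻¹ G`. -/
lemma mul_card_trivial_le (hm : 2 ≤ m) (h' : (X ^ p ^ m - X : F[X]).Splits)
    (χ : AddChar (scaledSpan (rootGroup p m F) (subfieldUnits p m F)) ℂ) (hχ : χ ≠ 0) :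
    p * Nat.card {t : subfieldUnits p m F // ∀ s, χ (scaleHom (rootGroup p m F) _ t s) = 1} ≤
      p ^ m - 1 := by
  have hp := (Fact.out : p.Prime)
  have hmem : ∀ (c : powFixedField p m F) (s : rootGroup p m F), 
      (c : F) * s ∈ scaledSpan (rootGroup p m F) (subfieldUnits p m F) := by
    intro c s
    rw [← SetLike.mem_coe, coe_scaledSpan]
    exact Submodule.smul_mem _ c (Submodule.subset_span s.2)
  -- The scalars `c ∈ 𝔽_q` for which `χ` is trivial on `c G`. It is proper, since the groups `c G`
  -- generate the whole span, so its index is a non-trivial power of `p`.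
  let K : AddSubgroup (powFixedField p m F) :=
    { carrier := {c | ∀ s : rootGroup p m F, χ ⟨(c : F) * s, hmem c s⟩ = 1}
      zero_mem' := fun s => by
        convert χ.map_zero_eq_one
        simp
      add_mem' := fun {a b} ha hb s => by
        have h : (⟨((a + b : powFixedField p m F) : F) * s, hmem _ s⟩ : scaledSpan _ _) =
            ⟨(a : F) * s, hmem a s⟩ + ⟨(b : F) * s, hmem b s⟩ := Subtype.ext (add_mul _ _ _)
        rw [h, AddChar.map_add_eq_mul, ha s, hb s, one_mul]
      neg_mem' := fun {a} ha s => by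
        have h : (⟨((-a : powFixedField p m F) : F) * s, hmem _ s⟩ : scaledSpan _ _) =
            -⟨(a : F) * s, hmem a s⟩ := Subtype.ext (neg_mul _ _)
        rw [h, AddChar.map_neg_eq_inv, ha s, inv_one] }
  have hK : K ≠ ⊤ := by
    intro hK
    refine hχ ?_
    ext ⟨w, hw⟩
    rw [AddChar.zero_apply]
    refine AddSubgroup.closure_induction (p := fun w hw => χ ⟨w, hw⟩ = 1) ?_ χ.map_zero_eq_one
      (fun x y hx hy h1 h2 => ?_) (fun x hx h1 => ?_) hw
    · rintro _ ⟨t, ht, s, hs, rfl⟩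
      have : (⟨(t : F), (mem_subfieldUnits_iff_coe p m F).1 ht⟩ : powFixedField p m F) ∈ K := by
        rw [hK]; trivial
      exact this ⟨s, hs⟩
    · exact (χ.map_add_eq_mul ⟨x, hx⟩ ⟨y, hy⟩).trans (by rw [h1, h2, one_mul])
    · exact (χ.map_neg_eq_inv ⟨x, hx⟩).trans (by rw [h1, inv_one])
  have hindex : K.index ∣ p ^ m := by
    rw [← card_powFixedField p m F (by omega) h']
    exact K.index_dvd_card
  have hpdvd : p ≤ K.index := by
    obtain ⟨i, -, hi⟩ := (Nat.dvd_prime_pow hp).1 hindex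
    rcases Nat.eq_zero_or_pos i with rfl | hi0
    · exact absurd (AddSubgroup.index_eq_one.1 (by simpa using hi)) hK
    · rw [hi]
      exact Nat.le_self_pow (by omega) p
  have hcard : p * Nat.card K ≤ p ^ m := by
    rw [← card_powFixedField p m F (by omega) h', ← K.card_mul_index, mul_comm]
    exact Nat.mul_le_mul_left _ hpdvd
  -- The inverses of the counted `t` lie in `K`, and `0 ∈ K` is an extra element, sent from `none`.
  -- This gives `q - p`, hence at most `q - 1`, after multiplying by `p`.
  let j : Option {t : subfieldUnits p m F // ∀ s, χ (scaleHom (rootGroup p m F) _ t s) = 1} → K :=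
    fun o => o.elim 0 fun t => ⟨⟨(((t.1 : Fˣ)⁻¹ : Fˣ) : F),
      (mem_subfieldUnits_iff_coe p m F).1 (inv_mem t.1.2)⟩, t.2⟩
  have hj : Function.Injective j := by
    have hne : ∀ t, j (some t) ≠ 0 := fun t h =>
      ((t.1 : Fˣ)⁻¹).ne_zero (Subtype.ext_iff.1 (Subtype.ext_iff.1 h))
    rintro (_ | t) (_ | t') h
    · rfl
    · exact absurd h.symm (hne t')
    · exact absurd h (hne t)
    · have h1 : (((t.1 : Fˣ)⁻¹ : Fˣ) : F) = ((t'.1 : Fˣ)⁻¹ : Fˣ) :=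
        Subtype.ext_iff.1 (Subtype.ext_iff.1 h)
      rw [Subtype.ext (Subtype.ext (inv_injective (Units.ext h1)))]
  have hle := Nat.card_le_card_of_injective j hj
  rw [Finite.card_option] at hle
  have := Nat.mul_le_mul_left p hle
  rw [mul_add, mul_one] at this
  have := hp.one_lt
  omega

variable [DecidableEq (LeftVertex (rootGroup p m F) (subfieldUnits p m F))]
  [Fintype (affGroup (rootGroup p m F) (subfieldUnits p m F))]

lemma sum_norm_sq_leftVertex_rootGroup_le (hm : 2 ≤ m) (h' : (X ^ p ^ m - X : F[X]).Splits)
    (f : RightVertex (rootGroup p m F) (subfieldUnits p m F) → ℂ) (hf : ∑ w, f w = 0) :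
    ∑ v, ‖∑ φ with leftEnd _ _ φ = v, f (rightEnd (rootGroup p m F) (subfieldUnits p m F) φ)‖ ^ 2 ≤
      1 / (p : ℝ) * (Nat.card (rootGroup p m F) * Nat.card (subfieldUnits p m F)) *
        ∑ w, ‖f w‖ ^ 2 := by
  have hp := (Fact.out : p.Prime).pos
  have hp' : (0 : ℝ) < p := by exact_mod_cast hp
  refine (sum_norm_sq_leftVertex_le (N := (p ^ m - 1) / p) (fun χ hχ => ?_) f hf).trans ?_
  · rw [Nat.le_div_iff_mul_le hp, mul_comm]
    exact mul_card_trivial_le p m hm h' χ hχ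
  · rw [card_subfieldUnits p m F (by omega) h']
    have h1 : (((p ^ m - 1) / p : ℕ) : ℝ) ≤ ((p ^ m - 1 : ℕ) : ℝ) / p := Nat.cast_div_le
    have h2 : (Nat.card (rootGroup p m F) : ℝ) * ((p ^ m - 1) / p : ℕ) ≤
        1 / (p : ℝ) * (Nat.card (rootGroup p m F) * ((p ^ m - 1 : ℕ) : ℝ)) := by
      calc _ ≤ (Nat.card (rootGroup p m F) : ℝ) * (((p ^ m - 1 : ℕ) : ℝ) / p) := by gcongr
        _ = _ := by ring
    gcongr

end Instance

/-- Slightly stronger than the stated spectral bound, which adds `1 / (q - 1)` under the root. -/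
lemma cosetSigmaTwo_le (p m : ℕ) {F : Type*} [Field F] [Fact p.Prime] [CharP F p] [Finite F]
    (hm : 2 ≤ m) (h' : (X ^ p ^ m - X : F[X]).Splits) :
    cosetSigmaTwo (rootGroup p m F) (subfieldUnits p m F) ≤ Real.sqrt (1 / (p : ℝ)) := by
  classical
  have := Fintype.ofFinite (affGroup (rootGroup p m F) (subfieldUnits p m F))
  exact secondSingularValue_le _ _ Nat.card_pos Nat.card_pos
    (sum_norm_sq_leftVertex_rootGroup_le p m hm h')

/-! ## Distance and dimension of evaluation codes -/

section Distance

variable {F : Type*} [Field F] {ι : Type*} [Finite ι]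

/-- By linearity distances are weights. A nonzero word is required because the infimum of the empty
set is `0`. -/
lemma le_minDist {C : Submodule F (ι → F)} {d : ℝ} (h0 : ∃ c ∈ C, c ≠ 0)
    (h : ∀ c ∈ C, c ≠ 0 → d ≤ ({i | c i ≠ 0}.ncard : ℝ)) : d ≤ (minDist C : ℝ) := by
  have hne : {d : ℕ | ∃ x ∈ C, ∃ y ∈ C, x ≠ y ∧ d = {i | x i ≠ y i}.ncard}.Nonempty := by
    obtain ⟨c, hc, hc0⟩ := h0
    exact ⟨_, c, hc, 0, zero_mem C, hc0, rfl⟩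
  obtain ⟨x, hx, y, hy, hxy, hd⟩ := Nat.sInf_mem hne
  have := h (x - y) (sub_mem hx hy) (sub_ne_zero.2 hxy)
  rw [minDist, hd]
  simpa [sub_ne_zero] using this

lemma le_relDist {C : Submodule F (ι → F)} {δ : ℝ} (hι : 0 < Nat.card ι) (h0 : ∃ c ∈ C, c ≠ 0)
    (h : ∀ c ∈ C, c ≠ 0 → δ * Nat.card ι ≤ ({i | c i ≠ 0}.ncard : ℝ)) : δ ≤ relDist C := by
  rw [relDist, le_div_iff₀ (by exact_mod_cast hι)]
  exact le_minDist h0 h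

/-- A nonzero Reed-Solomon word of degree `< k` has fewer than `k` zeros. -/
lemma card_lt_ncard_add_of_mem_rsCode {x : ι → F} (hx : Function.Injective x) {k : ℕ} {c : ι → F}
    (hc : c ∈ rsCode x k) (hc0 : c ≠ 0) : Nat.card ι < {i | c i ≠ 0}.ncard + k := by
  classical
  have := Fintype.ofFinite ι
  obtain ⟨P, hP, hcP⟩ := mem_rsCode.1 hc
  have hP0 : P ≠ 0 := by
    rintro rfl
    exact hc0 (funext fun i => by simp [hcP])
  have hz : ((Finset.univ.filter fun i => c i = 0).image x).card ≤ P.natDegree := by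
    refine le_trans (Finset.card_le_card ?_)
      ((Multiset.toFinset_card_le P.roots).trans (card_roots' P))
    intro y hy
    obtain ⟨i, hi, rfl⟩ := Finset.mem_image.1 hy
    simpa [hP0, ← hcP] using hi
  rw [Finset.card_image_of_injective _ hx] at hz
  have hk : P.natDegree < k := (natDegree_lt_iff_degree_lt hP0).2 hP
  have hsplit := Finset.card_filter_add_card_filter_not (s := (Finset.univ : Finset ι))
    (fun i => c i = 0)
  have hnc : {i | c i ≠ 0}.ncard = (Finset.univ.filter fun i => ¬ c i = 0).card := by
    rw [Set.ncard_eq_toFinset_card']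
    congr 1
    ext i
    simp
  rw [Finset.card_univ, ← Nat.card_eq_fintype_card] at hsplit
  omega

/-- No error term: a nonzero word has at most `⌈r N⌉₊ - 1 < r N` zeros, where `N` is the length. -/
lemma one_sub_mul_le_ncard_of_mem_rsCode {x : ι → F} (hx : Function.Injective x) {r : ℝ}
    (hr : 0 ≤ r) {c : ι → F} (hc : c ∈ rsCode x ⌈r * Nat.card ι⌉₊) (hc0 : c ≠ 0) :
    (1 - r) * Nat.card ι ≤ ({i | c i ≠ 0}.ncard : ℝ) := by
  have h1 : (Nat.card ι : ℝ) + 1 ≤ ({i | c i ≠ 0}.ncard : ℝ) + ⌈r * Nat.card ι⌉₊ := by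
    exact_mod_cast card_lt_ncard_add_of_mem_rsCode hx hc hc0
  have h2 := Nat.ceil_lt_add_one (show 0 ≤ r * Nat.card ι by positivity)
  linarith

lemma one_mem_rsCode (x : ι → F) {k : ℕ} (hk : 0 < k) : (fun _ => 1 : ι → F) ∈ rsCode x k :=
  mem_rsCode.2 ⟨1, by rw [degree_one]; exact_mod_cast hk, by simp⟩

lemma one_sub_le_relDist_rsCode {x : ι → F} (hx : Function.Injective x) (hι : 0 < Nat.card ι)
    {r : ℝ} (hr : 0 < r) : 1 - r ≤ relDist (rsCode x ⌈r * Nat.card ι⌉₊) := by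
  have := (Nat.card_pos_iff.1 hι).1
  refine le_relDist hι ⟨_, one_mem_rsCode x (Nat.ceil_pos.2 (by positivity)), ?_⟩ fun c hc hc0 =>
    one_sub_mul_le_ncard_of_mem_rsCode hx hr.le hc hc0
  exact fun h => one_ne_zero (congrFun h (Classical.arbitrary ι))

lemma finrank_rsCode_le (x : ι → F) (k : ℕ) : Module.finrank F (rsCode x k) ≤ k := by
  have := Module.Finite.equiv (degreeLTEquiv F k).symm
  refine (Submodule.finrank_map_le _ _).trans ?_
  rw [(degreeLTEquiv F k).finrank_eq, Module.finrank_fin_fun]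

lemma rate_rsCode_le (x : ι → F) (hι : 0 < Nat.card ι) {r : ℝ} (hr : 0 ≤ r) :
    rate (rsCode x ⌈r * Nat.card ι⌉₊) ≤ r + 1 / Nat.card ι := by
  have hι' : (0 : ℝ) < Nat.card ι := by exact_mod_cast hι
  have h1 : (Module.finrank F (rsCode x ⌈r * Nat.card ι⌉₊) : ℝ) ≤ ⌈r * Nat.card ι⌉₊ := by
    exact_mod_cast finrank_rsCode_le x _
  have h2 := Nat.ceil_lt_add_one (show 0 ≤ r * Nat.card ι by positivity)
  rw [rate, div_le_iff₀ hι', add_mul, one_div, inv_mul_cancel₀ hι'.ne']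
  linarith

end Distance

/-! ## Sets of edges with many edges at each of their vertices -/

section Mixing

lemma mul_le_of_le_quadratic {s n δ κ : ℝ} (hs : 0 < s) (hn : 0 < n) (hδ : 0 < δ)
    (h : s ≤ κ * s / δ + s * s / (δ ^ 2 * n)) : (δ ^ 2 - δ * κ) * n ≤ s := by
  have h1 : s * (δ ^ 2 * n) ≤ s * (δ * κ * n + s) := by
    calc s * (δ ^ 2 * n) ≤ (κ * s / δ + s * s / (δ ^ 2 * n)) * (δ ^ 2 * n) := by gcongr
      _ = s * (δ * κ * n + s) := by field_simp
  linarith [le_of_mul_le_mul_left h1 hs]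

variable {E L R : Type*} [Fintype E] [Fintype L] [Fintype R] [DecidableEq L] [DecidableEq R]

set_option maxHeartbeats 800000 in
/-- In a biregular bipartite graph with second singular value `√μ`, a set of edges that contains
at least a fraction `δ` of the edges at each of its vertices is large. -/
lemma mul_card_le_card_of_local (left : E → L) (right : E → R) {dL dR : ℕ} {μ δ : ℝ}
    (hdL : ∀ v, (Finset.univ.filter fun e => left e = v).card = dL)
    (hdR : ∀ w, (Finset.univ.filter fun e => right e = w).card = dR)
    (hμ : 0 ≤ μ) (hδ : 0 < δ)
    (hspec : ∀ f : R → ℂ, ∑ w, f w = 0 →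
      ∑ v, ‖∑ e with left e = v, f (right e)‖ ^ 2 ≤ μ * (dL * dR) * ∑ w, ‖f w‖ ^ 2)
    (S : Finset E) (hS : S.Nonempty)
    (hSL : ∀ e ∈ S, δ * dL ≤ ((S.filter fun e' => left e' = left e).card : ℝ))
    (hSR : ∀ e ∈ S, δ * dR ≤ ((S.filter fun e' => right e' = right e).card : ℝ)) :
    (δ ^ 2 - δ * Real.sqrt μ) * Fintype.card E ≤ (S.card : ℝ) := by
  classical
  obtain ⟨e₀, he₀⟩ := hS
  have hs : (0 : ℝ) < S.card := by exact_mod_cast Finset.card_pos.2 ⟨e₀, he₀⟩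
  have hn : (0 : ℝ) < Fintype.card E := by exact_mod_cast Fintype.card_pos_iff.2 ⟨e₀⟩
  have hR : (0 : ℝ) < Fintype.card R := by exact_mod_cast Fintype.card_pos_iff.2 ⟨right e₀⟩
  have hE : (Fintype.card E : ℝ) = dR * Fintype.card R := by
    have := Finset.card_eq_sum_card_fiberwise (s := (Finset.univ : Finset E)) (t := Finset.univ)
      (f := right) (fun _ _ => Finset.mem_coe.2 (Finset.mem_univ _))
    rw [Finset.card_univ] at this
    rw [this, Finset.sum_congr rfl fun w _ => hdR w, Finset.sum_const, Finset.card_univ,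
      smul_eq_mul, Nat.cast_mul, mul_comm]
  -- `A` and `B` are the endpoints of `S`. The local condition bounds `δ dL |A|` and `δ dR |B|` by
  -- `|S|`, while `|S|` is at most the number of edges between `A` and `B`.
  set A := S.image left with hA
  set B := S.image right with hB
  have hcardA : (S.card : ℝ) = ∑ v ∈ A, ((S.filter fun e => left e = v).card : ℝ) := by
    exact_mod_cast Finset.card_eq_sum_card_image left S
  have hcardB : (S.card : ℝ) = ∑ v ∈ B, ((S.filter fun e => right e = v).card : ℝ) := by
    exact_mod_cast Finset.card_eq_sum_card_image right S
  set x : ℝ := δ * dL * A.card with hx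
  set y : ℝ := δ * dR * B.card with hy
  have hxs : x ≤ S.card := by
    rw [hcardA, hx, mul_comm, ← nsmul_eq_mul]
    refine Finset.card_nsmul_le_sum _ _ _ fun v hv => ?_
    obtain ⟨e, he, rfl⟩ := Finset.mem_image.1 hv
    exact hSL e he
  have hys : y ≤ S.card := by
    rw [hcardB, hy, mul_comm, ← nsmul_eq_mul]
    refine Finset.card_nsmul_le_sum _ _ _ fun v hv => ?_
    obtain ⟨e, he, rfl⟩ := Finset.mem_image.1 hv
    exact hSR e he
  have hx0 : 0 ≤ x := by positivity
  have hy0 : 0 ≤ y := by positivity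
  set β : ℝ := B.card / Fintype.card R with hβ
  -- The indicator of `B` minus its mean, to which the spectral hypothesis applies.
  set f : R → ℝ := fun w => (if w ∈ B then 1 else 0) - β with hf
  have hfsum : ∑ w, f w = 0 := by
    simp only [hf, Finset.sum_sub_distrib, Finset.sum_ite_mem, Finset.univ_inter,
      Finset.sum_const, Finset.card_univ, nsmul_eq_mul, mul_one, hβ]
    field_simp
    ring
  have hfsq : ∑ w, f w ^ 2 ≤ B.card := by
    have h1 : ∀ w, f w ^ 2 = (if w ∈ B then 1 else 0) - β * (if w ∈ B then 1 else 0) - β * f w := by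
      intro w
      simp only [hf]
      split_ifs <;> ring
    simp only [h1, Finset.sum_sub_distrib, ← Finset.mul_sum, hfsum]
    simp only [Finset.sum_ite_mem, Finset.univ_inter, Finset.sum_const, nsmul_eq_mul, mul_one,
      mul_zero, sub_zero]
    have : 0 ≤ β * B.card := by positivity
    linarith
  set T : L → ℝ := fun v => ∑ e with left e = v, f (right e) with hT
  have hTsq : ∑ v, T v ^ 2 ≤ μ * (dL * dR) * B.card := by
    have h1 := hspec (fun w => (f w : ℂ)) (by rw [← Complex.ofReal_sum, hfsum, Complex.ofReal_zero])
    simp only [← Complex.ofReal_sum, Complex.norm_real, Real.norm_eq_abs, sq_abs] at h1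
    refine h1.trans ?_
    gcongr
  have hsum : (S.card : ℝ) ≤ ∑ v ∈ A, (T v + β * dL) := by
    rw [hcardA]
    refine Finset.sum_le_sum fun v _ => ?_
    have h1 : T v + β * dL = ∑ e with left e = v, (if right e ∈ B then (1 : ℝ) else 0) := by
      simp only [hT, hf, Finset.sum_sub_distrib, Finset.sum_const, nsmul_eq_mul, hdL]
      ring
    rw [h1, Finset.sum_boole]
    refine Nat.cast_le.2 (Finset.card_le_card fun e he => ?_)
    obtain ⟨he1, he2⟩ := Finset.mem_filter.1 he
    exact Finset.mem_filter.2 ⟨Finset.mem_filter.2 ⟨Finset.mem_univ _, he2⟩,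
      Finset.mem_image_of_mem _ he1⟩
  rw [Finset.sum_add_distrib, Finset.sum_const, nsmul_eq_mul] at hsum
  -- Deviation from the expected edge count, by Cauchy–Schwarz over `A` and the spectral bound; the
  -- product `|A| |B|` is then controlled through `x` and `y`.
  have hCS : ∑ v ∈ A, T v ≤ Real.sqrt μ * S.card / δ := by
    have h1 : (∑ v ∈ A, T v) ^ 2 ≤ μ * (S.card / δ) ^ 2 := by
      calc (∑ v ∈ A, T v) ^ 2 ≤ A.card * ∑ v ∈ A, T v ^ 2 := sq_sum_le_card_mul_sum_sq
        _ ≤ A.card * (μ * (dL * dR) * B.card) := by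
          gcongr
          exact (Finset.sum_le_univ_sum_of_nonneg fun v => sq_nonneg _).trans hTsq
        _ = μ * (x / δ * (y / δ)) := by
          rw [hx, hy]
          field_simp
        _ ≤ μ * (S.card / δ * (S.card / δ)) := by gcongr
        _ = μ * (S.card / δ) ^ 2 := by ring
    have h2 := Real.le_sqrt_of_sq_le h1
    rwa [Real.sqrt_mul hμ, Real.sqrt_sq (by positivity), ← mul_div_assoc] at h2
  have hmain : (A.card : ℝ) * (β * dL) = x * y / (δ ^ 2 * Fintype.card E) := by
    have hdR0 : (dR : ℝ) ≠ 0 := by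
      rintro h
      rw [h, zero_mul] at hE
      exact hn.ne' hE
    rw [hβ, hE, hx, hy]
    field_simp
  rw [hmain] at hsum
  have hxy : x * y ≤ S.card * S.card := by gcongr
  have h1 : (S.card : ℝ) ≤ Real.sqrt μ * S.card / δ +
      S.card * S.card / (δ ^ 2 * Fintype.card E) := by
    refine hsum.trans (add_le_add hCS ?_)
    gcongr
  exact mul_le_of_le_quadratic hs hn hδ h1

end Mixing

/-! ## Parameters of the local codes and of the evaluation code -/

section Parameters

universe u

variable {F : Type u} [Field F] [Finite F] {U : AddSubgroup F} {V : Subgroup Fˣ} {α : F}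

lemma leftLocalCode_params (hα : ∀ φ ∈ affGroup U V, φ α = α → φ = 1) {r : ℝ} (hr : 0 < r)
    (v : LeftVertex U V) : rate (leftLocalCode U V α r v) ≤ r + 1 / Nat.card U ∧
      1 - r ≤ relDist (leftLocalCode U V α r v) := by
  have hcard := card_leftFiber v
  have hpos : 0 < Nat.card {φ : affGroup U V // leftEnd U V φ = v} := hcard ▸ Nat.card_pos
  rw [leftLocalCode, ← hcard]
  exact ⟨rate_rsCode_le _ hpos hr.le, one_sub_le_relDist_rsCode (fun φ ψ h =>
    Subtype.ext ((edgePoint_bijective hα).1 (Subtype.ext h))) hpos hr⟩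

lemma rightLocalCode_params (hα : ∀ φ ∈ affGroup U V, φ α = α → φ = 1) {r : ℝ} (hr : 0 < r)
    (v : RightVertex U V) : rate (rightLocalCode U V α r v) ≤ r + 1 / Nat.card V ∧
      1 - r ≤ relDist (rightLocalCode U V α r v) := by
  have hcard := card_rightFiber v
  have hpos : 0 < Nat.card {φ : affGroup U V // rightEnd U V φ = v} := hcard ▸ Nat.card_pos
  rw [rightLocalCode, ← hcard]
  exact ⟨rate_rsCode_le _ hpos hr.le, one_sub_le_relDist_rsCode (fun φ ψ h =>
    Subtype.ext ((edgePoint_bijective hα).1 (Subtype.ext h))) hpos hr⟩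

lemma card_Omega (hα : ∀ φ ∈ affGroup U V, φ α = α → φ = 1) :
    Nat.card (Omega U V α) = Nat.card (affGroup U V) :=
  (Nat.card_congr (Equiv.ofBijective _ (edgePoint_bijective hα))).symm

lemma one_mem_messageSpace {r : ℝ} (hr : 0 < r) {D : ℕ} (hD : 0 < D) :
    (1 : F[X]) ∈ messageSpace U V r D := by
  have hU : 0 < Nat.card U := Nat.card_pos
  have hV : 0 < Nat.card V := Nat.card_pos
  refine ⟨by rw [degree_one]; exact_mod_cast hD, ?_, ?_⟩
  · rw [baseDegree_lt_iff]
    exact degree_baseDigit_lt_of_mem_baseSpan (by rwa [natDegree_annihilator])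
      (Nat.ceil_pos.2 (by positivity)) (one_mem_baseSpan _ 0)
  · rw [baseDegree_lt_iff]
    exact degree_baseDigit_lt_of_mem_baseSpan (by rwa [natDegree_scalingInvariant])
      (Nat.ceil_pos.2 (by positivity)) (one_mem_baseSpan _ 0)

lemma exists_mem_code_ne_zero {r : ℝ} (hr : 0 < r) {D : ℕ} (hD : 0 < D) :
    ∃ c ∈ code U V α r D, c ≠ 0 := by
  refine ⟨fun _ => 1, mem_code.2 ⟨1, one_mem_messageSpace hr hD, by simp⟩, fun h => ?_⟩
  exact one_ne_zero (congrFun h (edgePoint U V α 1))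

lemma code_le_rsCode (r : ℝ) (D : ℕ) :
    code U V α r D ≤ rsCode (fun x : Omega U V α => (x : F)) D := by
  intro c hc
  obtain ⟨f, hf, h⟩ := mem_code.1 hc
  exact mem_rsCode.2 ⟨f, hf.1, h⟩

lemma card_Omega_pos : 0 < Nat.card (Omega U V α) :=
  Nat.card_pos_iff.2 ⟨⟨edgePoint U V α 1⟩, inferInstance⟩

lemma one_sub_div_le_relDist_code {r : ℝ} (hr : 0 < r) {D : ℕ} (hD : 0 < D) :
    1 - (D : ℝ) / Nat.card (Omega U V α) ≤ relDist (code U V α r D) := by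
  have hpos : (0 : ℝ) < Nat.card (Omega U V α) := by exact_mod_cast card_Omega_pos
  refine le_relDist card_Omega_pos (exists_mem_code_ne_zero hr hD) fun c hc hc0 => ?_
  have h := card_lt_ncard_add_of_mem_rsCode Subtype.val_injective (code_le_rsCode r D hc) hc0
  have h' : (Nat.card (Omega U V α) : ℝ) ≤ ({i | c i ≠ 0}.ncard : ℝ) + D := by
    exact_mod_cast h.le
  rw [sub_mul, one_mul, div_mul_cancel₀ _ hpos.ne']
  linarith

open Classical in
/-- The distance of a code inside the Tanner code, from a spectral bound. -/
lemma sq_sub_le_relDist_code [Fintype (affGroup U V)]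
    (hα : ∀ φ ∈ affGroup U V, φ α = α → φ = 1) {r μ : ℝ} (hr : 0 < r) (hr1 : r < 1) (hμ : 0 ≤ μ)
    (hspec : ∀ f : RightVertex U V → ℂ, ∑ w, f w = 0 →
      ∑ v, ‖∑ φ with leftEnd U V φ = v, f (rightEnd U V φ)‖ ^ 2 ≤
        μ * (Nat.card U * Nat.card V) * ∑ w, ‖f w‖ ^ 2) {D : ℕ} (hD : 0 < D) :
    (1 - r) ^ 2 - (1 - r) * Real.sqrt μ ≤ relDist (code U V α r D) := by
  refine le_relDist card_Omega_pos (exists_mem_code_ne_zero hr hD) fun c hc hc0 => ?_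
  set c' : affGroup U V → F := fun φ => c (edgePoint U V α φ) with hc'
  have hc'T : c' ∈ cosetTannerCode U V α r := codeOnEdges_le α r D ⟨c, hc, rfl⟩
  set S : Finset (affGroup U V) := Finset.univ.filter fun φ => c' φ ≠ 0 with hS
  have hncard : {i | c i ≠ 0}.ncard = S.card := by
    rw [← Set.ncard_coe_finset, ← Set.ncard_image_of_injective _ (edgePoint_bijective hα).1]
    congr 1
    ext x
    obtain ⟨φ, rfl⟩ := (edgePoint_bijective hα).2 x
    simp only [Set.mem_image, hS, Finset.coe_filter, Finset.mem_univ, true_and, hc']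
    exact ⟨fun h => ⟨φ, h, rfl⟩, fun ⟨ψ, h, h'⟩ => h' ▸ h⟩
  have hSne : S.Nonempty := by
    obtain ⟨x, hx⟩ := Function.ne_iff.1 hc0
    obtain ⟨φ, rfl⟩ := (edgePoint_bijective hα).2 x
    exact ⟨φ, Finset.mem_filter.2 ⟨Finset.mem_univ _, hx⟩⟩
  have hlocal : ∀ (P : affGroup U V → Prop) (x : {φ // P φ} → F) (hx : Function.Injective x)
      (φ : affGroup U V), φ ∈ S → P φ →
      (fun ψ : {φ // P φ} => c' ψ) ∈ rsCode x ⌈r * Nat.card {φ // P φ}⌉₊ →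
      (1 - r) * Nat.card {φ // P φ} ≤ ((S.filter P).card : ℝ) := by
    intro P x hx φ hφ hPφ hmem
    have h1 := one_sub_mul_le_ncard_of_mem_rsCode hx hr.le hmem
      (fun h => (Finset.mem_filter.1 hφ).2 (congrFun h ⟨φ, hPφ⟩))
    refine h1.trans_eq ?_
    rw [← Set.ncard_image_of_injective _ Subtype.val_injective, ← Set.ncard_coe_finset]
    congr 2
    ext ψ
    simp only [Set.mem_image, Finset.coe_filter, hS, Finset.mem_filter, Finset.mem_univ, true_and]
    exact ⟨fun ⟨a, h, h'⟩ => h' ▸ ⟨h, a.2⟩, fun ⟨h, h'⟩ => ⟨⟨ψ, h'⟩, h, rfl⟩⟩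
  rw [hncard, card_Omega hα, Nat.card_eq_fintype_card]
  refine mul_card_le_card_of_local (leftEnd U V) (rightEnd U V) (dL := Nat.card U)
    (dR := Nat.card V) ?_ ?_ hμ (by linarith) hspec S hSne ?_ ?_
  · intro v
    rw [← card_leftFiber v, Nat.card_eq_fintype_card, Fintype.card_subtype]
  · intro v
    rw [← card_rightFiber v, Nat.card_eq_fintype_card, Fintype.card_subtype]
  · intro φ hφ
    have h := hc'T.1 (leftEnd U V φ)
    rw [leftLocalCode, ← card_leftFiber (leftEnd U V φ)] at h
    rw [← card_leftFiber (leftEnd U V φ)]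
    exact hlocal _ _ (fun φ ψ h => Subtype.ext ((edgePoint_bijective hα).1 (Subtype.ext h)))
      φ hφ rfl h
  · intro φ hφ
    have h := hc'T.2 (rightEnd U V φ)
    rw [rightLocalCode, ← card_rightFiber (rightEnd U V φ)] at h
    rw [← card_rightFiber (rightEnd U V φ)]
    exact hlocal _ _ (fun φ ψ h => Subtype.ext ((edgePoint_bijective hα).1 (Subtype.ext h)))
      φ hφ rfl h

/-- The dimension of the code is at least the number of degrees of monic message polynomials. -/
lemma card_le_finrank_code {r : ℝ} {D : ℕ} (hD : D ≤ Nat.card (Omega U V α)) (S : Finset ℕ)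
    (hS : ∀ t ∈ S, ∃ f ∈ messageSpace U V r D, f.Monic ∧ f.natDegree = t) :
    S.card ≤ Module.finrank F (code U V α r D) := by
  classical
  set M := messageSpace U V r D with hM
  set ev := evalMap fun x : Omega U V α => (x : F) with hev
  -- A message polynomial has degree below `D ≤ |Ω|`, so it cannot vanish on all of `Ω` unless it is
  -- zero.
  have hinj : Function.Injective (ev.domRestrict M) := by
    rw [← LinearMap.ker_eq_bot, LinearMap.ker_eq_bot']
    rintro ⟨f, hf⟩ h
    refine Subtype.ext ?_
    by_contra hf0
    have := Fintype.ofFinite (Omega U V α)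
    refine hf0 (eq_zero_of_degree_lt_of_eval_finset_eq_zero (Omega U V α).toFinset ?_
      fun x hx => ?_)
    · refine hf.1.trans_le ?_
      rw [Set.toFinset_card, ← Nat.card_eq_fintype_card]
      exact_mod_cast hD
    · exact congrFun h ⟨x, Set.mem_toFinset.1 hx⟩
  have : Module.Finite F M := Module.Finite.of_injective _ hinj
  have hfin : Module.finrank F (code U V α r D) = Module.finrank F M := by
    rw [← LinearMap.finrank_range_of_inj hinj, LinearMap.range_domRestrict]
    rfl
  rw [hfin]
  choose! f hfM hfmon hfdeg using hS
  -- Polynomials of distinct degrees are independent; the degrees outside `S` are filled with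
  -- monomials.
  let seq : Polynomial.Sequence F :=
    { elems' := fun t => if t ∈ S then f t else X ^ t
      degree_eq' := fun t => by
        split_ifs with ht
        · rw [degree_eq_natDegree (hfmon t ht).ne_zero, hfdeg t ht]
        · exact degree_X_pow t }
  have hind : LinearIndependent F fun t : S => (⟨f t, hfM t t.2⟩ : M) := by
    refine LinearIndependent.of_comp M.subtype ?_
    have h1 := seq.linearIndependent.comp (fun t : S => (t : ℕ)) Subtype.val_injective
    have h2 : M.subtype ∘ (fun t : S => (⟨f t, hfM t t.2⟩ : M)) =
        seq ∘ fun t : S => (t : ℕ) := funext fun t => (if_pos t.2).symm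
    rw [h2]
    exact h1
  simpa using hind.fintype_card_le_finrank

end Parameters

/-! ## The parameters of the instantiation -/

section InstanceParameters

variable {p m : ℕ} {F : Type*} [Field F] [Fact p.Prime] [CharP F p] {α : F}

lemma one_lt_cast_pow {p m : ℕ} (hp : 2 ≤ p) (hm : m ≠ 0) : (1 : ℝ) < (p : ℝ) ^ m :=
  one_lt_pow₀ (by exact_mod_cast hp) hm

lemma cast_codeLength {p : ℕ} (hp : 2 ≤ p) (m : ℕ) :
    (codeLength p m : ℝ) = ((p : ℝ) ^ m) ^ m * ((p : ℝ) ^ m - 1) := by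
  rw [codeLength, Nat.cast_mul, Nat.cast_sub (Nat.one_le_pow _ _ (by omega)), sq, pow_mul]
  push_cast
  rfl

lemma codeLength_pos {p m : ℕ} (hp : 2 ≤ p) (hm : m ≠ 0) : (0 : ℝ) < codeLength p m := by
  have h := one_lt_cast_pow hp hm
  have : (0 : ℝ) < (p : ℝ) ^ m - 1 := by linarith
  rw [cast_codeLength hp]
  positivity

lemma Admissible.card_Omega [Finite F] (h : Admissible p m F α) (hm : 2 ≤ m) :
    Nat.card (Omega (rootGroup p m F) (subfieldUnits p m F) α) = codeLength p m := by
  rw [AlgExpander.card_Omega h.free, card_affGroup_rootGroup p m F hm h.splits_add h.splits_mul]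

/-- The lower bound for the rate, as a function of `q = p ^ m` and `x = D / n`. -/
noncomputable def rateBound (m : ℕ) (r q x : ℝ) : ℝ :=
  ((q - 1) / q) ^ (2 * m - 1) * (r ^ (2 * m) - max 0 (r - (x - 1 / (q - 1))) ^ (2 * m)) /
    (2 * m).factorial

lemma Admissible.rateBound_le_rate_code [Finite F] (h : Admissible p m F α) (hm : 2 ≤ m) {r : ℝ}
    (hr : 0 < r) (hr1 : r < 1) {D : ℕ} (hD : D ≤ codeLength p m) :
    rateBound m r ((p : ℝ) ^ m) (D / codeLength p m) ≤
      rate (code (rootGroup p m F) (subfieldUnits p m F) α r D) := by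
  have hp := (Fact.out : p.Prime).two_le
  have hn := codeLength_pos hp (by omega : m ≠ 0)
  have hn_eq := cast_codeLength hp m
  have hq := one_lt_cast_pow hp (by omega : m ≠ 0)
  have hcardG := card_rootGroup p m F hm h.splits_add
  have hcardH := card_subfieldUnits p m F (by omega) h.splits_mul
  have hcardH' : ((Nat.card (subfieldUnits p m F) : ℕ) : ℝ) = (p : ℝ) ^ m - 1 := by
    rw [hcardH, Nat.cast_sub (Nat.one_le_pow _ _ (by omega))]
    push_cast
    rfl
  have hpm : ((p ^ m : ℕ) : ℝ) = (p : ℝ) ^ m := by push_cast; rfl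
  set q : ℝ := (p : ℝ) ^ m with hqdef
  -- Degrees counted up to `q ^ m * E` stay below `D`, and weight below `r (q - 1)` meets the digit
  -- bounds for both `|G| = q` and `|H| = q - 1`.
  set E : ℕ := D / (p ^ m) ^ m with hE
  have hR : 0 < r * (q - 1) := mul_pos hr (by linarith)
  obtain ⟨S, hS, hcard⟩ := exists_lowDegrees p m F hm E hR (by nlinarith)
  have hSle : S.card ≤ Module.finrank F
      (code (rootGroup p m F) (subfieldUnits p m F) α r D) := by
    refine card_le_finrank_code (by rwa [h.card_Omega hm]) S fun t ht => ?_
    obtain ⟨htE, w, hw, f, hf, rfl, hfg, hfh⟩ := hS t ht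
    have hwq : (w : ℝ) < q - 1 := hw.trans (by nlinarith)
    have hwH : w < Nat.card (subfieldUnits p m F) := by
      rw [← hcardH'] at hwq
      exact_mod_cast hwq
    have hwG : w < Nat.card (rootGroup p m F) := by
      have : (w : ℝ) < (p ^ m : ℕ) := by rw [hpm]; linarith
      rw [hcardG]
      exact_mod_cast this
    refine ⟨f, ⟨?_, ?_, ?_⟩, hf, rfl⟩
    · rw [degree_eq_natDegree hf.ne_zero]
      exact_mod_cast htE.trans_le (Nat.mul_div_le _ _)
    · rw [baseDegree_lt_iff]
      rw [← annihilator_rootGroup p m F hm h.splits_add] at hfg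
      refine degree_baseDigit_lt_of_mem_baseSpan (by rwa [natDegree_annihilator])
        (Nat.lt_ceil.2 ?_) hfg
      rw [hcardG, hpm]
      linarith
    · rw [baseDegree_lt_iff]
      have hinv : (scalingInvariant (subfieldUnits p m F) : F[X]) = X ^ (p ^ m - 1) := by
        rw [scalingInvariant, hcardH]
      rw [← hinv] at hfh
      refine degree_baseDigit_lt_of_mem_baseSpan (by rwa [natDegree_scalingInvariant])
        (Nat.lt_ceil.2 ?_) hfh
      rwa [hcardH']
  have hSle' : (S.card : ℝ) ≤ Module.finrank F
      (code (rootGroup p m F) (subfieldUnits p m F) α r D) := by exact_mod_cast hSle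
  rw [rate, h.card_Omega hm, le_div_iff₀ hn]
  refine le_trans ?_ (hcard.trans hSle')
  set x : ℝ := (D : ℝ) / codeLength p m with hx
  have hq0 : (0 : ℝ) < q := by linarith
  have hq1 : (0 : ℝ) < q - 1 := by linarith
  -- Rounding `D / q ^ m` down costs at most `1`, which is the `1 / (q - 1)` in `rateBound` after
  -- scaling.
  have hEge : (D : ℝ) / q ^ m - 1 ≤ E := by
    have h1 : D < (p ^ m) ^ m * (E + 1) := by
      rw [hE, mul_comm]
      exact Nat.lt_mul_of_div_lt (Nat.lt_succ_self _) (by positivity)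
    have h2 : (D : ℝ) < q ^ m * (E + 1) := by
      rw [← hpm]
      exact_mod_cast h1
    rw [sub_le_iff_le_add, div_le_iff₀ (by positivity)]
    linarith
  have hxD : (q - 1) * x = D / q ^ m := by
    rw [hx, hn_eq]
    field_simp
  have hmax : max 0 (r * (q - 1) - E) ≤ (q - 1) * max 0 (r - (x - 1 / (q - 1))) := by
    refine max_le (by positivity) ?_
    calc r * (q - 1) - E ≤ r * (q - 1) - (D / q ^ m - 1) := by linarith
      _ = (q - 1) * (r - (x - 1 / (q - 1))) := by
        rw [← hxD]
        field_simp
      _ ≤ _ := by gcongr; exact le_max_right _ _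
  have hpow : max 0 (r * (q - 1) - E) ^ (2 * m) ≤
      (q - 1) ^ (2 * m) * max 0 (r - (x - 1 / (q - 1))) ^ (2 * m) := by
    rw [← mul_pow]
    exact pow_le_pow_left₀ (le_max_left _ _) hmax _
  calc rateBound m r q x * codeLength p m
      = q⁻¹ ^ (m - 1) * ((q - 1) ^ (2 * m) * r ^ (2 * m) -
          (q - 1) ^ (2 * m) * max 0 (r - (x - 1 / (q - 1))) ^ (2 * m)) / (2 * m).factorial := by
        obtain ⟨k, rfl⟩ : ∃ k, m = k + 1 := ⟨m - 1, by omega⟩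
        rw [hn_eq, rateBound, ← mul_sub, show 2 * (k + 1) - 1 = 2 * k + 1 by omega,
          Nat.add_sub_cancel, div_pow, inv_pow]
        generalize max 0 (r - (x - 1 / (q - 1))) = y
        field_simp
        ring
    _ ≤ _ := by
        rw [mul_pow r, mul_comm (r ^ (2 * m))]
        gcongr

lemma Admissible.sq_sub_le_relDist_code [Finite F] (h : Admissible p m F α) (hm : 2 ≤ m) {r : ℝ}
    (hr : 0 < r) (hr1 : r < 1) {D : ℕ} (hD : 0 < D) :
    (1 - r) ^ 2 - (1 - r) * Real.sqrt (1 / (p : ℝ)) ≤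
      relDist (code (rootGroup p m F) (subfieldUnits p m F) α r D) := by
  classical
  have := Fintype.ofFinite (affGroup (rootGroup p m F) (subfieldUnits p m F))
  refine AlgExpander.sq_sub_le_relDist_code h.free hr hr1 (by positivity) (fun f hf => ?_) hD
  convert sum_norm_sq_leftVertex_rootGroup_le p m hm h.splits_mul f hf

end InstanceParameters

/-! ## Asymptotics -/

section Asymptotics

/-- On `[s, r] ⊆ [0, 1]` the integrand `t ^ k / k!` of the left side is at most the integrand `t ^
(k - 1) / (k - 1)!` of the right side. It weakens the counted exponent `2 m` to the stated `2 m +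
1`. -/
lemma pow_succ_sub_div_factorial_le {r s : ℝ} (hs : 0 ≤ s) (hsr : s ≤ r) (hr : r ≤ 1) {k : ℕ}
    (hk : 0 < k) :
    (r ^ (k + 1) - s ^ (k + 1)) / (k + 1).factorial ≤ (r ^ k - s ^ k) / k.factorial := by
  obtain ⟨k, rfl⟩ : ∃ j, k = j + 1 := ⟨k - 1, by omega⟩
  have hr0 : 0 ≤ r := hs.trans hsr
  have hs1 : s ≤ 1 := hsr.trans hr
  have h1 : s ^ k ≤ r ^ k := pow_le_pow_left₀ hs hsr k
  have hsk : 0 ≤ s ^ k := pow_nonneg hs k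
  have h2 : 0 ≤ r ^ (k + 1) - s ^ (k + 1) := sub_nonneg.2 (pow_le_pow_left₀ hs hsr _)
  have h3 : s ^ (k + 1) * (r - s) ≤ r ^ (k + 1) - s ^ (k + 1) := by
    calc s ^ (k + 1) * (r - s) ≤ s ^ k * (r - s) := by
          have := sub_nonneg.2 hsr
          gcongr ?_ * _
          exact pow_le_pow_of_le_one hs hs1 (Nat.le_succ k)
      _ ≤ s ^ k * (r - s) + r * (r ^ k - s ^ k) :=
          le_add_of_nonneg_right (mul_nonneg hr0 (sub_nonneg.2 h1))
      _ = r ^ (k + 1) - s ^ (k + 1) := by ring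
  have h4 : r ^ (k + 1 + 1) - s ^ (k + 1 + 1) ≤
      ((k + 1 + 1 : ℕ) : ℝ) * (r ^ (k + 1) - s ^ (k + 1)) := by
    calc r ^ (k + 1 + 1) - s ^ (k + 1 + 1)
        = r * (r ^ (k + 1) - s ^ (k + 1)) + s ^ (k + 1) * (r - s) := by ring
      _ ≤ 1 * (r ^ (k + 1) - s ^ (k + 1)) + (r ^ (k + 1) - s ^ (k + 1)) := by gcongr
      _ = 2 * (r ^ (k + 1) - s ^ (k + 1)) := by ring
      _ ≤ _ := by
        gcongr
        exact_mod_cast (by omega : 2 ≤ k + 1 + 1)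
  rw [Nat.factorial_succ (k + 1), Nat.cast_mul, ← div_div]
  gcongr
  rw [div_le_iff₀ (by positivity)]
  linarith

lemma tendsto_natCast_pow {m : ℕ} (hm : m ≠ 0) :
    Tendsto (fun p : ℕ => (p : ℝ) ^ m) atTop atTop :=
  (tendsto_pow_atTop hm).comp tendsto_natCast_atTop_atTop

lemma tendsto_rateBound {m : ℕ} (hm : m ≠ 0) (r : ℝ) {ρ : ℝ} {l : Filter ℕ} (hl : l ≤ atTop)
    {x : ℕ → ℝ} (hx : Tendsto x l (𝓝 ρ)) :
    Tendsto (fun p : ℕ => rateBound m r ((p : ℝ) ^ m) (x p)) l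
      (𝓝 ((r ^ (2 * m) - max 0 (r - ρ) ^ (2 * m)) / (2 * m).factorial)) := by
  have hq : Tendsto (fun p : ℕ => (p : ℝ) ^ m) l atTop := (tendsto_natCast_pow hm).mono_left hl
  have hq1 : Tendsto (fun p : ℕ => (p : ℝ) ^ m - 1) l atTop :=
    tendsto_atTop_add_const_right _ _ hq
  have h1 : Tendsto (fun p : ℕ => 1 / ((p : ℝ) ^ m - 1)) l (𝓝 0) :=
    hq1.const_div_atTop 1
  have h2 : Tendsto (fun p : ℕ => ((p : ℝ) ^ m - 1) / (p : ℝ) ^ m) l (𝓝 1) := by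
    have h : Tendsto (fun p : ℕ => 1 - ((p : ℝ) ^ m)⁻¹) l (𝓝 (1 - 0)) :=
      tendsto_const_nhds.sub hq.inv_tendsto_atTop
    rw [sub_zero] at h
    refine h.congr' ?_
    filter_upwards [hq.eventually_gt_atTop 0] with p hp
    rw [sub_div, div_self hp.ne', one_div]
  have h3 := ((h2.pow (2 * m - 1)).mul ((tendsto_const_nhds (x := r ^ (2 * m))).sub
    (((tendsto_const_nhds (x := (0 : ℝ))).max
      ((tendsto_const_nhds (x := r)).sub (hx.sub h1))).pow (2 * m)))).div_const
        ((2 * m).factorial : ℝ)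
  simpa [rateBound] using h3

/-- `n = q ^ m (q - 1)` lies between `(q / 2) ^ (m + 1)` and `q ^ (m + 1)`. -/
lemma half_le_codeLength_rpow {p m : ℕ} (hp : 2 ≤ p) (hm : m ≠ 0) :
    (p : ℝ) ^ m / 2 ≤ (p : ℝ) ^ m - 1 ∧
    (p : ℝ) ^ m / 2 ≤ (codeLength p m : ℝ) ^ (1 / ((m : ℝ) + 1)) ∧
    (codeLength p m : ℝ) ^ (1 / ((m : ℝ) + 1)) ≤ (p : ℝ) ^ m := by
  have hq : (2 : ℝ) ≤ (p : ℝ) ^ m :=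
    calc (2 : ℝ) ≤ p := by exact_mod_cast hp
      _ ≤ (p : ℝ) ^ m := le_self_pow₀ (by exact_mod_cast (by omega : 1 ≤ p)) hm
  have hn := codeLength_pos hp hm
  have hn_eq := cast_codeLength hp m
  set q : ℝ := (p : ℝ) ^ m with hqdef
  have hroot : ∀ y : ℝ, 0 ≤ y → (y ^ (m + 1)) ^ (1 / ((m : ℝ) + 1)) = y := fun y hy => by
    have := Real.pow_rpow_inv_natCast hy (Nat.succ_ne_zero m)
    rw [one_div]
    simpa using this
  refine ⟨by linarith, ?_, ?_⟩
  · rw [← hroot (q / 2) (by positivity)]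
    refine Real.rpow_le_rpow (by positivity) ?_ (by positivity)
    rw [hn_eq, pow_succ]
    gcongr
    · linarith
    · linarith
  · conv_rhs => rw [← hroot q (by positivity)]
    refine Real.rpow_le_rpow hn.le ?_ (by positivity)
    rw [hn_eq, pow_succ]
    gcongr
    linarith

lemma isTheta_codeLength_rpow {m : ℕ} (hm : m ≠ 0) :
    ((fun p : ℕ => (p : ℝ) ^ m) =Θ[atTop]
      fun p : ℕ => (codeLength p m : ℝ) ^ (1 / ((m : ℝ) + 1))) ∧
    ((fun p : ℕ => (p : ℝ) ^ m - 1) =Θ[atTop]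
      fun p : ℕ => (codeLength p m : ℝ) ^ (1 / ((m : ℝ) + 1))) := by
  have key : ∀ {f g : ℕ → ℝ}, (∀ p : ℕ, 2 ≤ p → 0 ≤ f p ∧ 0 ≤ g p ∧ f p ≤ 2 * g p) →
      f =O[atTop] g := by
    intro f g hfg
    refine IsBigO.of_bound 2 ?_
    filter_upwards [eventually_ge_atTop 2] with p hp
    obtain ⟨h1, h2, h3⟩ := hfg p hp
    rwa [Real.norm_of_nonneg h1, Real.norm_of_nonneg h2]
  refine ⟨⟨key fun p hp => ?_, key fun p hp => ?_⟩, ⟨key fun p hp => ?_, key fun p hp => ?_⟩⟩ <;>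
  · obtain ⟨h1, h2, h3⟩ := half_le_codeLength_rpow hp hm
    have h4 : (0 : ℝ) ≤ (p : ℝ) ^ m := by positivity
    refine ⟨?_, ?_, ?_⟩ <;> linarith

end Asymptotics

end AlgExpander

/-! ### Assembly of the exact and asymptotic statements -/

theorem theorem4p2 (m : ℕ) (hm : 2 ≤ m) (r ρ : ℝ) (hr0 : 0 < r) (hr1 : r < 1)
    (hρ0 : 0 < ρ) (hρ1 : ρ ≤ 1) (D : ℕ → ℕ)
    (hD : ∀ p : ℕ, p.Prime → D p ≤ AlgExpander.codeLength p m)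
    (hDρ : Tendsto (fun p : ℕ => (D p : ℝ) / (AlgExpander.codeLength p m : ℝ))
      (atTop ⊓ 𝓟 {p : ℕ | p.Prime}) (𝓝 ρ)) :
    -- for every prime `p` there is an instance of the construction
    (∀ (p : ℕ) [Fact p.Prime], ∃ (F : Type) (_ : Field F) (_ : Finite F) (_ : CharP F p) (α : F),
      AlgExpander.Admissible p m F α) ∧
    -- exact properties of every instance
    (∀ (p : ℕ) [Fact p.Prime] (F : Type*) [Field F] [Finite F] [CharP F p] (α : F),
      AlgExpander.Admissible p m F α →
      let G := AlgExpander.rootGroup p m F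
      let H := AlgExpander.subfieldUnits p m F
      -- the invariant polynomials and the length of the code
      AlgExpander.annihilator G = X ^ p ^ m + X ^ p + X ∧
      AlgExpander.scalingInvariant H = X ^ (p ^ m - 1) ∧
      Nat.card (AlgExpander.Omega G H α) = AlgExpander.codeLength p m ∧
      Function.Bijective (AlgExpander.edgePoint G H α) ∧
      -- the two local lengths
      (∀ v, Nat.card {φ // AlgExpander.leftEnd G H φ = v} = p ^ m) ∧
      (∀ v, Nat.card {φ // AlgExpander.rightEnd G H φ = v} = p ^ m - 1) ∧
      -- the code is an expander code with Reed-Solomon local codes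
      AlgExpander.codeOnEdges G H α r (D p) ≤ AlgExpander.cosetTannerCode G H α r ∧
      AlgExpander.codeOnEdges G H α r (AlgExpander.codeLength p m) =
        AlgExpander.cosetTannerCode G H α r ∧
      AlgExpander.cosetSigmaTwo G H ≤ Real.sqrt (1 / (p : ℝ) + 1 / ((p : ℝ) ^ m - 1))) ∧
    -- the local lengths scale as `n ^ (1 / (m + 1))`
    ((fun p : ℕ => (p : ℝ) ^ m) =Θ[atTop]
      fun p : ℕ => (AlgExpander.codeLength p m : ℝ) ^ (1 / ((m : ℝ) + 1))) ∧
    ((fun p : ℕ => (p : ℝ) ^ m - 1) =Θ[atTop]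
      fun p : ℕ => (AlgExpander.codeLength p m : ℝ) ^ (1 / ((m : ℝ) + 1))) ∧
    -- the asymptotic parameters
    (∀ ε : ℝ, 0 < ε → ∃ P : ℕ, ∀ (p : ℕ) [Fact p.Prime], P ≤ p →
      ∀ (F : Type*) [Field F] [Finite F] [CharP F p] (α : F), AlgExpander.Admissible p m F α →
      let G := AlgExpander.rootGroup p m F
      let H := AlgExpander.subfieldUnits p m F
      let n := AlgExpander.codeLength p m
      -- local rate and local relative distance
      (∀ v, AlgExpander.rate (AlgExpander.leftLocalCode G H α r v) ≤ r + ε ∧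
        1 - r - ε ≤ AlgExpander.relDist (AlgExpander.leftLocalCode G H α r v)) ∧
      (∀ v, AlgExpander.rate (AlgExpander.rightLocalCode G H α r v) ≤ r + ε ∧
        1 - r - ε ≤ AlgExpander.relDist (AlgExpander.rightLocalCode G H α r v)) ∧
      -- global relative distance and global rate
      max (1 - ρ) ((1 - r) ^ 2) - ε ≤ AlgExpander.relDist (AlgExpander.code G H α r (D p)) ∧
      (r ^ (2 * m + 1) - max 0 (r - ρ) ^ (2 * m + 1)) / ((2 * m + 1).factorial : ℝ) - ε ≤
        AlgExpander.rate (AlgExpander.code G H α r (D p)) ∧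
      -- the case `D = n`
      (1 - r) ^ 2 - ε ≤ AlgExpander.relDist (AlgExpander.code G H α r n) ∧
      r ^ (2 * m + 1) / ((2 * m + 1).factorial : ℝ) - ε ≤
        AlgExpander.rate (AlgExpander.code G H α r n)) ∧
    0 < r ^ (2 * m + 1) / ((2 * m + 1).factorial : ℝ) := by
  have hm0 : m ≠ 0 := by omega
  refine ⟨fun p _ => AlgExpander.exists_admissible p m hm, ?_,
    (AlgExpander.isTheta_codeLength_rpow hm0).1, (AlgExpander.isTheta_codeLength_rpow hm0).2, ?_,
    by positivity⟩
  · intro p _ F _ _ _ α h G H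
    have hp := (Fact.out : p.Prime).two_le
    have hcardG : Nat.card G = p ^ m := AlgExpander.card_rootGroup p m F hm h.splits_add
    have hcardH : Nat.card H = p ^ m - 1 := AlgExpander.card_subfieldUnits p m F hm0 h.splits_mul
    refine ⟨AlgExpander.annihilator_rootGroup p m F hm h.splits_add, ?_, h.card_Omega hm,
      AlgExpander.edgePoint_bijective h.free, fun v => ?_, fun v => ?_,
      AlgExpander.codeOnEdges_le α r (D p), ?_, ?_⟩
    · rw [AlgExpander.scalingInvariant, hcardH]
    · rw [AlgExpander.card_leftFiber, hcardG]
    · rw [AlgExpander.card_rightFiber, hcardH]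
    · rw [← AlgExpander.card_affGroup_rootGroup p m F hm h.splits_add h.splits_mul]
      exact AlgExpander.codeOnEdges_eq h.free hr1.le
    · refine (AlgExpander.cosetSigmaTwo_le p m hm h.splits_mul).trans (Real.sqrt_le_sqrt ?_)
      have := AlgExpander.one_lt_cast_pow hp hm0
      have : (0 : ℝ) ≤ 1 / ((p : ℝ) ^ m - 1) := one_div_nonneg.2 (by linarith)
      linarith
  · intro ε hε
    set l : Filter ℕ := atTop ⊓ 𝓟 {p : ℕ | p.Prime} with hl
    have hl_le : l ≤ atTop := inf_le_left
    have hp_tend : Tendsto (fun p : ℕ => (p : ℝ)) l atTop :=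
      tendsto_natCast_atTop_atTop.mono_left hl_le
    have hq_tend : Tendsto (fun p : ℕ => (p : ℝ) ^ m) l atTop :=
      (AlgExpander.tendsto_natCast_pow hm0).mono_left hl_le
    have hprime : ∀ᶠ p in l, p.Prime := mem_inf_of_right (mem_principal_self _)
    have hq : ∀ᶠ p : ℕ in l, 1 / (p : ℝ) ^ m < ε := by
      have h : Tendsto (fun p : ℕ => 1 / (p : ℝ) ^ m) l (𝓝 0) :=
        hq_tend.const_div_atTop 1
      exact h.eventually_lt_const hε
    have hq1 : ∀ᶠ p : ℕ in l, 1 / ((p : ℝ) ^ m - 1) < ε := by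
      have h : Tendsto (fun p : ℕ => 1 / ((p : ℝ) ^ m - 1)) l (𝓝 0) :=
        (tendsto_atTop_add_const_right _ (-1 : ℝ) hq_tend).const_div_atTop 1
      exact h.eventually_lt_const hε
    have hsqrt : ∀ᶠ p : ℕ in l, (1 - r) * Real.sqrt (1 / (p : ℝ)) < ε := by
      have h : Tendsto (fun p : ℕ => (1 - r) * Real.sqrt (1 / (p : ℝ))) l
          (𝓝 ((1 - r) * Real.sqrt 0)) :=
        (hp_tend.const_div_atTop 1).sqrt.const_mul _
      rw [Real.sqrt_zero, mul_zero] at h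
      exact h.eventually_lt_const hε
    -- Since `ρ > 0`, eventually `D p > 0`, so the code contains the constant word `1` and its
    -- minimum distance is not the default `0`.
    have hDpos : ∀ᶠ p : ℕ in l, 0 < (D p : ℝ) / (AlgExpander.codeLength p m : ℝ) :=
      hDρ.eventually_const_lt hρ0
    have hDle : ∀ᶠ p : ℕ in l, (D p : ℝ) / (AlgExpander.codeLength p m : ℝ) < ρ + ε :=
      hDρ.eventually_lt_const (by linarith)
    have hone : Tendsto (fun p : ℕ => ((AlgExpander.codeLength p m : ℕ) : ℝ) /
        (AlgExpander.codeLength p m : ℝ)) l (𝓝 1) := by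
      refine tendsto_const_nhds.congr' ?_
      filter_upwards [hprime] with p hp
      exact (div_self (AlgExpander.codeLength_pos hp.two_le hm0).ne').symm
    have hrate : ∀ᶠ p : ℕ in l,
        (r ^ (2 * m + 1) - max 0 (r - ρ) ^ (2 * m + 1)) / ((2 * m + 1).factorial : ℝ) - ε <
          AlgExpander.rateBound m r ((p : ℝ) ^ m)
            ((D p : ℝ) / (AlgExpander.codeLength p m : ℝ)) := by
      refine (AlgExpander.tendsto_rateBound hm0 r hl_le hDρ).eventually_const_lt ?_
      have := AlgExpander.pow_succ_sub_div_factorial_le (k := 2 * m) (le_max_left 0 (r - ρ))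
        (max_le hr0.le (by linarith)) hr1.le (by omega)
      linarith
    have hrate1 : ∀ᶠ p : ℕ in l, r ^ (2 * m + 1) / ((2 * m + 1).factorial : ℝ) - ε <
        AlgExpander.rateBound m r ((p : ℝ) ^ m)
          (((AlgExpander.codeLength p m : ℕ) : ℝ) / (AlgExpander.codeLength p m : ℝ)) := by
      refine (AlgExpander.tendsto_rateBound hm0 r hl_le hone).eventually_const_lt ?_
      have := AlgExpander.pow_succ_sub_div_factorial_le (k := 2 * m) (le_max_left 0 (r - 1))
        (max_le hr0.le (by linarith)) hr1.le (by omega)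
      have h0 : max 0 (r - 1) = 0 := max_eq_left (by linarith)
      rw [h0] at this ⊢
      rw [zero_pow (by omega), sub_zero] at this
      linarith
    have hall := hq.and (hq1.and (hsqrt.and (hDpos.and (hDle.and (hrate.and hrate1)))))
    -- All the inequalities depend on `p` alone, so one threshold serves every field and base point.
    rw [hl, eventually_inf_principal, eventually_atTop] at hall
    obtain ⟨P, hP⟩ := hall
    refine ⟨P, ?_⟩
    intro p hpF hPp F _ _ _ α h G H n
    obtain ⟨hq, hq1, hsqrt, hDpos, hDle, hrate, hrate1⟩ := hP p hPp hpF.out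
    have hp := hpF.out.two_le
    have hcardG : Nat.card G = p ^ m := AlgExpander.card_rootGroup p m F hm h.splits_add
    have hcardH : Nat.card H = p ^ m - 1 := AlgExpander.card_subfieldUnits p m F hm0 h.splits_mul
    have hn := AlgExpander.codeLength_pos hp hm0
    have hD0 : 0 < D p := by
      rw [div_pos_iff_of_pos_right hn] at hDpos
      exact_mod_cast hDpos
    have hn0 : 0 < n := by exact_mod_cast hn
    refine ⟨fun v => ?_, fun v => ?_, ?_, ?_, ?_, ?_⟩
    · have := AlgExpander.leftLocalCode_params h.free hr0 v
      rw [hcardG] at this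
      push_cast at this
      exact ⟨this.1.trans (by linarith), (by linarith : 1 - r - ε ≤ 1 - r).trans this.2⟩
    · have := AlgExpander.rightLocalCode_params h.free hr0 v
      rw [hcardH, Nat.cast_sub (Nat.one_le_pow _ _ (by omega))] at this
      push_cast at this
      exact ⟨this.1.trans (by linarith), (by linarith : 1 - r - ε ≤ 1 - r).trans this.2⟩
    · rw [sub_le_iff_le_add]
      refine max_le ?_ ?_
      · have := AlgExpander.one_sub_div_le_relDist_code (U := G) (V := H) (α := α) hr0 hD0
        rw [h.card_Omega hm] at this
        linarith
      · have := h.sq_sub_le_relDist_code hm hr0 hr1 hD0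
        linarith
    · exact hrate.le.trans (h.rateBound_le_rate_code hm hr0 hr1 (hD p hpF.out))
    · have := h.sq_sub_le_relDist_code hm hr0 hr1 hn0
      linarith
    · exact hrate1.le.trans (h.rateBound_le_rate_code hm hr0 hr1 le_rfl)
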